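/- Let $m,n\ge 1$, let $X$ be a random real $m\times n$ matrix whose rows are independent (the entries within a row may depend on each other in an arbitrary way), and let $S=X'X/m$. Write $\lambda_1(S)\le\dots\le\lambda_n(S)$ for the eigenvalues of $S$, $F_S(\lambda)=\frac1n\#\{i:\lambda_i(S)\le\lambda\}$ for $\lambda\in\mathbb R$, and $F_S(f)=\frac1n\sum_{i=1}^n f(\lambda_i(S))$ for $f:\mathbb R\to\mathbb R$. Fix $f:\mathbb R\to\mathbb R$. In the bounds below, $\exp[-a/0]$ for $a>0$ is read as $0$. (i) Suppose that $|X_{ij}|\le 1$ almost surely for all $i,j$ and that $x\mapsto f(x^2)$ is convex and Lipschitz on $\mathbb R$, with (smallest) Lipschitz constant $\|f(\cdot^2)\|_L$. Then for every median $\operatorname{med}F_S(f)$ of $F_S(f)$ and every $\varepsilon>0$, $$P\bigl(|F_S(f)-\operatorname{med}F_S(f)|\ge\varepsilon\bigr)\le 4\exp\left[-\frac{nm}{n+m}\,\frac{\varepsilon^2}{8\|f(\cdot^2)\|_L^2}\right].$$ A similar bound holds around the mean: $F_S(f)$ is integrable, and for every $\varepsilon>0$, $$P\bigl(|F_S(f)-\mathbb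 E F_S(f)|\ge\varepsilon\bigr)\le C\exp\left[-c\,\frac{nm}{n+m}\,\frac{\varepsilon^2}{\|f(\cdot^2)\|_L^2}\right],$$ where $C,c>0$ are absolute constants (independent of $m$, $n$, $f$, $\varepsilon$ and the law of $X$). (ii) Suppose that $f$ is of bounded variation on $\mathbb R$, that is, $V_f(\mathbb R)=\sup_{k\ge1}\sup_{x_0\le x_1\le\dots\le x_k}\sum_{j=1}^k|f(x_j)-f(x_{j-1})|<\infty$ (no bound on the entries of $X$ is assumed here). Then $F_S(f)$ is integrable, and for every $\varepsilon>0$, $$P\bigl(|F_S(f)-\mathbb E F_S(f)|\ge\varepsilon\bigr)\le 2\exp\left[-\frac{n^2}{m}\,\frac{2\varepsilon^2}{V_f(\mathbb R)^2}\right].$$ In particular, for every $\lambda\in\mathbb R$ and $\varepsilon>0$, $$P\bigl(|F_S(\lambda)-\mathbb E F_S(\lambda)|\ge\varepsilon\bigr)\le 2\exp\left[-\frac{n^2}{m}\,2\varepsilon^2\right].$$ -/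

import Mathlib

open MeasureTheory ProbabilityTheory
open scoped NNReal

noncomputable section

namespace SpectralConcentration

/-- The empirical covariance (Wishart) matrix `S = X'X/m` of an `m × n` matrix `X`. -/
def wishart {m n : ℕ} (X : Matrix (Fin m) (Fin n) ℝ) : Matrix (Fin n) (Fin n) ℝ :=
  (m : ℝ)⁻¹ • (X.transpose * X)

theorem wishart_isHermitian {m n : ℕ} (X : Matrix (Fin m) (Fin n) ℝ) :
    (wishart X).IsHermitian := by
  show (wishart X).conjTranspose = wishart X
  simp [wishart, Matrix.conjTranspose_eq_transpose_of_trivial,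
    Matrix.transpose_mul]

/-- `F_A(f) = n⁻¹ ∑ i, f (λ_i(A))`, the sum running over the eigenvalues of the real symmetric
`n × n` matrix `A`, counted with multiplicity. -/
def spectralIntegral {n : ℕ} {A : Matrix (Fin n) (Fin n) ℝ} (hA : A.IsHermitian)
    (f : ℝ → ℝ) : ℝ :=
  (n : ℝ)⁻¹ * ∑ i, f (hA.eigenvalues i)

/-- `F_A(t) = n⁻¹ #{i | λ_i(A) ≤ t}`, the c.d.f. of the spectral distribution of the real
symmetric `n × n` matrix `A`. -/
def spectralCDF {n : ℕ} {A : Matrix (Fin n) (Fin n) ℝ} (hA : A.IsHermitian) (t : ℝ) : ℝ :=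
  (n : ℝ)⁻¹ * ((Finset.univ.filter fun i => hA.eigenvalues i ≤ t).card : ℝ)

/-- `M` is a median of the real random variable `T` on the probability space `(Ω, μ)`. -/
def IsMedian {Ω : Type*} [MeasurableSpace Ω] (μ : Measure Ω) (T : Ω → ℝ) (M : ℝ) : Prop :=
  1 / 2 ≤ μ.real {ω | T ω ≤ M} ∧ 1 / 2 ≤ μ.real {ω | M ≤ T ω}

/-- The Lipschitz constant of a Lipschitz function `g`: its smallest Lipschitz bound. -/
def lipConst (g : ℝ → ℝ) : ℝ :=
  ((sInf {K : ℝ≥0 | LipschitzWith K g} : ℝ≥0) : ℝ)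

/-- The total variation of `f` on the whole real line (for `f` of bounded variation). -/
def totalVariation (f : ℝ → ℝ) : ℝ :=
  (eVariationOn f Set.univ).toReal

/-- `exp (-a / v)` for `a > 0` and `v ≥ 0`, with the usual convention `exp (-a / 0) = 0`. -/
def expNegDiv (a v : ℝ) : ℝ :=
  if v = 0 then 0 else Real.exp (-(a / v))

end SpectralConcentration

end

/-! Both parts are concentration inequalities for functions of independent rows; they differ in the
regularity that `F_S(f)` has in `X`.

Part (i). The squared eigenvalues of the Hermitian dilation of `X/√m` are, up to zeros, those of `S`
taken twice. So `F_S(f)` is, up to a constant, the trace of `g = f(·²)` at a matrix linear in `X`.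
Peierls' inequality makes this trace convex in `X` and Lipschitz in the Frobenius norm, with
constant `L √((n+m)/(2n²m))`. Entries within a row may be dependent, so a row is treated as one
variable in a set of squared diameter at most `4n`. Maurey's infimum-convolution inequality for
convex functions (`lintegral_mul_lintegral_exp_neg_le`) tensorises over rows. Applied to a
truncation of `F_S(f)` it bounds the product of opposite tails, hence the deviation from a median;
applied to a multiple of `F_S(f)` it bounds `E e^{aT} · E e^{-aT}`, which by Jensen controls the
centred Laplace transform.

Part (ii). Replacing one row changes the quadratic form of `S` by rank-one terms. By dimension
counting the number of eigenvalues in `(-∞, t]` moves by at most one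
(`card_eigenvalues_wishart_updateRow` and its converse), so old and new eigenvalues of equal rank
bound non-overlapping intervals. The sum of `f` over the eigenvalues therefore moves by at most
`V_f`, not `n V_f`, and McDiarmid's inequality with differences `V_f/n` gives the bound. -/

namespace SpectralConcentration

/-! ### Trace functions of symmetric matrices: convexity and Lipschitz bounds -/

section Spectral

open Matrix

variable {ι : Type*} [Fintype ι]

theorem sq_dotProduct_mulVec_le (A : Matrix ι ι ℝ) (x : EuclideanSpace ℝ ι) (hx : ‖x‖ = 1) :
    (x.ofLp ⬝ᵥ A *ᵥ x.ofLp) ^ 2 ≤ ‖WithLp.toLp 2 (A *ᵥ x.ofLp)‖ ^ 2 := by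
  have h1 : x.ofLp ⬝ᵥ A *ᵥ x.ofLp = inner ℝ x (WithLp.toLp 2 (A *ᵥ x.ofLp)) := by
    rw [EuclideanSpace.inner_eq_star_dotProduct, dotProduct_comm]
    simp
  rw [h1]
  have := abs_real_inner_le_norm x (WithLp.toLp 2 (A *ᵥ x.ofLp))
  rw [hx, one_mul] at this
  exact sq_le_sq' (by linarith [neg_abs_le (inner ℝ x (WithLp.toLp 2 (A *ᵥ x.ofLp)))])
    ((le_abs_self _).trans this)

/-- Parseval applied to each row of `A`: the Frobenius norm does not depend on the orthonormal
basis. -/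
theorem sum_norm_sq_mulVec_orthonormalBasis {κ : Type*} [Fintype κ] (A : Matrix κ ι ℝ)
    (u : OrthonormalBasis ι ℝ (EuclideanSpace ℝ ι)) :
    ∑ i, ‖WithLp.toLp 2 (A *ᵥ (u i).ofLp)‖ ^ 2 = ∑ k, ∑ i, A k i ^ 2 := by
  have h (k : κ) : ∑ i, (A *ᵥ (u i).ofLp) k ^ 2 = ∑ i, A k i ^ 2 := by
    have := u.sum_sq_norm_inner_right (WithLp.toLp 2 (A k))
    rw [EuclideanSpace.norm_sq_eq] at this
    simp only [Real.norm_eq_abs, sq_abs] at this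
    rw [← this]
    refine Finset.sum_congr rfl fun i _ => ?_
    rw [EuclideanSpace.inner_eq_star_dotProduct]
    simp [mulVec]
  simp only [EuclideanSpace.norm_sq_eq, Real.norm_eq_abs, sq_abs]
  rw [Finset.sum_comm]
  exact Finset.sum_congr rfl fun k _ => h k

variable [DecidableEq ι]

theorem dotProduct_mulVec_eq_sum_eigenvalues {A : Matrix ι ι ℝ} (hA : A.IsHermitian)
    (x : EuclideanSpace ℝ ι) :
    x.ofLp ⬝ᵥ A *ᵥ x.ofLp =
      ∑ j, hA.eigenvalues j * (inner ℝ (hA.eigenvectorBasis j) x) ^ 2 := by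
  have h1 : x.ofLp ⬝ᵥ A *ᵥ x.ofLp = inner ℝ x (WithLp.toLp 2 (A *ᵥ x.ofLp)) := by
    rw [EuclideanSpace.inner_eq_star_dotProduct, dotProduct_comm]
    simp
  have h2 (j : ι) : inner ℝ (hA.eigenvectorBasis j) (WithLp.toLp 2 (A *ᵥ x.ofLp)) =
      hA.eigenvalues j * inner ℝ (hA.eigenvectorBasis j) x := by
    rw [EuclideanSpace.inner_eq_star_dotProduct, EuclideanSpace.inner_eq_star_dotProduct]
    have h3 : Aᵀ = A := by simpa [conjTranspose_eq_transpose_of_trivial] using hA.eq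
    simp only [star_trivial]
    rw [dotProduct_comm, dotProduct_mulVec, ← mulVec_transpose, h3, hA.mulVec_eigenvectorBasis,
      smul_dotProduct, dotProduct_comm, smul_eq_mul]
  rw [h1, ← hA.eigenvectorBasis.sum_inner_mul_inner]
  refine Finset.sum_congr rfl fun j _ => ?_
  rw [h2, real_inner_comm]
  ring

theorem eigenvectorBasis_dotProduct_mulVec {A : Matrix ι ι ℝ} (hA : A.IsHermitian) (i : ι) :
    (hA.eigenvectorBasis i).ofLp ⬝ᵥ A *ᵥ (hA.eigenvectorBasis i).ofLp = hA.eigenvalues i := by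
  rw [hA.eigenvalues_eq]
  simp

/-- **Peierls' inequality**. -/
theorem sum_convex_quadForm_le {A : Matrix ι ι ℝ} (hA : A.IsHermitian) {g : ℝ → ℝ}
    (hg : ConvexOn ℝ Set.univ g) (u : OrthonormalBasis ι ℝ (EuclideanSpace ℝ ι)) :
    ∑ i, g ((u i).ofLp ⬝ᵥ A *ᵥ (u i).ofLp) ≤ ∑ i, g (hA.eigenvalues i) := by
  set v := hA.eigenvectorBasis
  have hrow (i : ι) : ∑ j, (inner ℝ (v j) (u i)) ^ 2 = 1 := by
    have := v.sum_sq_norm_inner_right (u i)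
    simpa using this
  have hcol (j : ι) : ∑ i, (inner ℝ (v j) (u i)) ^ 2 = 1 := by
    have := u.sum_sq_norm_inner_left (v j)
    simpa using this
  calc ∑ i, g ((u i).ofLp ⬝ᵥ A *ᵥ (u i).ofLp)
      ≤ ∑ i, ∑ j, (inner ℝ (v j) (u i)) ^ 2 * g (hA.eigenvalues j) := by
        refine Finset.sum_le_sum fun i _ => ?_
        rw [dotProduct_mulVec_eq_sum_eigenvalues hA]
        have := hg.map_sum_le (t := Finset.univ) (w := fun j => (inner ℝ (v j) (u i)) ^ 2)
          (p := hA.eigenvalues) (fun j _ => sq_nonneg _) (hrow i) (fun j _ => Set.mem_univ _)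
        simpa [mul_comm] using this
    _ = ∑ j, g (hA.eigenvalues j) := by
        rw [Finset.sum_comm]
        refine Finset.sum_congr rfl fun j _ => ?_
        rw [← Finset.sum_mul, hcol, one_mul]

/-- In an eigenbasis of `C` the eigenvalues are quadratic forms, hence linear in the matrix; scalar
convexity splits them, and Peierls returns to the spectra of `A` and `B`. -/
theorem sum_convex_eigenvalues_convex {A B C : Matrix ι ι ℝ} (hA : A.IsHermitian)
    (hB : B.IsHermitian) (hC : C.IsHermitian) {g : ℝ → ℝ} (hg : ConvexOn ℝ Set.univ g)
    {a b : ℝ} (ha : 0 ≤ a) (hb : 0 ≤ b) (hab : a + b = 1) (h : C = a • A + b • B) :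
    ∑ i, g (hC.eigenvalues i) ≤
      a * ∑ i, g (hA.eigenvalues i) + b * ∑ i, g (hB.eigenvalues i) := by
  set u := hC.eigenvectorBasis
  calc ∑ i, g (hC.eigenvalues i)
      = ∑ i, g (a • ((u i).ofLp ⬝ᵥ A *ᵥ (u i).ofLp) + b • ((u i).ofLp ⬝ᵥ B *ᵥ (u i).ofLp)) := by
        refine Finset.sum_congr rfl fun i _ => ?_
        have e (x : ι → ℝ) : x ⬝ᵥ C *ᵥ x = a • (x ⬝ᵥ A *ᵥ x) + b • (x ⬝ᵥ B *ᵥ x) := by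
          simp [h, add_mulVec, smul_mulVec]
        rw [← e, eigenvectorBasis_dotProduct_mulVec hC i]
    _ ≤ ∑ i, (a * g ((u i).ofLp ⬝ᵥ A *ᵥ (u i).ofLp) + b * g ((u i).ofLp ⬝ᵥ B *ᵥ (u i).ofLp)) :=
        Finset.sum_le_sum fun i _ => hg.2 (Set.mem_univ _) (Set.mem_univ _) ha hb hab
    _ ≤ _ := by
        rw [Finset.sum_add_distrib, ← Finset.mul_sum, ← Finset.mul_sum]
        exact add_le_add (mul_le_mul_of_nonneg_left (sum_convex_quadForm_le hA hg u) ha)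
          (mul_le_mul_of_nonneg_left (sum_convex_quadForm_le hB hg u) hb)

/-- Evaluate both quadratic forms in an eigenbasis of `A`: this is exact for `A`, and by Peierls a
lower bound for `B`. Cauchy–Schwarz over the diagonal entries of `A - B` gives the factor `√(card
ι)`. -/
theorem sum_convex_eigenvalues_sub_le {A B : Matrix ι ι ℝ} (hA : A.IsHermitian)
    (hB : B.IsHermitian) {g : ℝ → ℝ} (hg : ConvexOn ℝ Set.univ g) {L : ℝ} (hL : 0 ≤ L)
    (hgL : ∀ x y, |g x - g y| ≤ L * |x - y|) :
    ∑ i, g (hA.eigenvalues i) - ∑ i, g (hB.eigenvalues i) ≤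
      L * (√(Fintype.card ι) * √(∑ i, ∑ j, (A i j - B i j) ^ 2)) := by
  set u := hA.eigenvectorBasis
  calc ∑ i, g (hA.eigenvalues i) - ∑ i, g (hB.eigenvalues i)
      ≤ ∑ i, g ((u i).ofLp ⬝ᵥ A *ᵥ (u i).ofLp) - ∑ i, g ((u i).ofLp ⬝ᵥ B *ᵥ (u i).ofLp) := by
        gcongr ?_ - ?_
        · simp [u, eigenvectorBasis_dotProduct_mulVec]
        · exact sum_convex_quadForm_le hB hg u
    _ ≤ ∑ i, L * |(u i).ofLp ⬝ᵥ (A - B) *ᵥ (u i).ofLp| := by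
        rw [← Finset.sum_sub_distrib]
        refine Finset.sum_le_sum fun i _ => ?_
        rw [sub_mulVec, dotProduct_sub]
        exact (le_abs_self _).trans (hgL _ _)
    _ ≤ _ := by
        rw [← Finset.mul_sum]
        gcongr
        rw [← Real.sqrt_mul (by positivity)]
        apply Real.le_sqrt_of_sq_le
        refine sq_sum_le_card_mul_sum_sq.trans ?_
        rw [Finset.card_univ]
        refine mul_le_mul_of_nonneg_left ?_ (by positivity)
        simp only [sq_abs]
        refine (Finset.sum_le_sum fun i _ =>
          sq_dotProduct_mulVec_le (A - B) (u i) (u.orthonormal.1 i)).trans ?_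
        rw [sum_norm_sq_mulVec_orthonormalBasis]
        simp

theorem abs_sum_convex_eigenvalues_sub_le {A B : Matrix ι ι ℝ} (hA : A.IsHermitian)
    (hB : B.IsHermitian) {g : ℝ → ℝ} (hg : ConvexOn ℝ Set.univ g) {L : ℝ} (hL : 0 ≤ L)
    (hgL : ∀ x y, |g x - g y| ≤ L * |x - y|) :
    |∑ i, g (hA.eigenvalues i) - ∑ i, g (hB.eigenvalues i)| ≤
      L * (√(Fintype.card ι) * √(∑ i, ∑ j, (A i j - B i j) ^ 2)) := by
  rw [abs_le']
  refine ⟨sum_convex_eigenvalues_sub_le hA hB hg hL hgL, ?_⟩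
  have := sum_convex_eigenvalues_sub_le hB hA hg hL hgL
  rw [neg_sub]
  simpa only [sub_sq_comm (B _ _)] using this

theorem sum_eigenvalues_eq_roots {A : Matrix ι ι ℝ} (hA : A.IsHermitian) (f : ℝ → ℝ) :
    ∑ i, f (hA.eigenvalues i) = (A.charpoly.roots.map f).sum := by
  rw [hA.roots_charpoly_eq_eigenvalues, Multiset.map_map]
  rfl

theorem roots_charpoly_mul_self {A : Matrix ι ι ℝ} (hA : A.IsHermitian) :
    (A * A).charpoly.roots = A.charpoly.roots.map (fun x => x ^ 2) := by
  have h : A * A = cfc (fun x : ℝ => x ^ 2) A := by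
    rw [cfc_pow_id (R := ℝ) A 2 hA.isSelfAdjoint, sq]
  rw [h, hA.charpoly_cfc_eq, hA.roots_charpoly_eq_eigenvalues, Polynomial.roots_prod]
  · simp only [Polynomial.roots_X_sub_C, Multiset.bind_singleton, Multiset.map_map]
    rfl
  · exact Finset.prod_ne_zero_iff.2 fun i _ => Polynomial.X_sub_C_ne_zero _

end Spectral

/-! ### Linearisation of the Wishart matrix by the Hermitian dilation -/

section Dilation

open Matrix

variable {m n : ℕ}

/-- The Hermitian dilation of `X / √m`. -/
noncomputable def dilation (X : Matrix (Fin m) (Fin n) ℝ) :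
    Matrix (Fin n ⊕ Fin m) (Fin n ⊕ Fin m) ℝ :=
  (√(m : ℝ))⁻¹ • fromBlocks 0 Xᵀ X 0

theorem dilation_isHermitian (X : Matrix (Fin m) (Fin n) ℝ) : (dilation X).IsHermitian := by
  rw [IsHermitian, conjTranspose_eq_transpose_of_trivial]
  simp [dilation, fromBlocks_transpose]

theorem dilation_mul_self (X : Matrix (Fin m) (Fin n) ℝ) :
    dilation X * dilation X = fromBlocks (wishart X) 0 0 ((m : ℝ)⁻¹ • (X * Xᵀ)) := by
  have h : (√(m : ℝ))⁻¹ * (√(m : ℝ))⁻¹ = (m : ℝ)⁻¹ := by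
    rw [← mul_inv, Real.mul_self_sqrt (by positivity)]
  simp [dilation, fromBlocks_multiply, smul_smul, h, wishart, fromBlocks_smul]

/-- The square of the dilation is block diagonal with blocks `S` and `XX'/m`, whose characteristic
polynomials agree up to powers of the variable. Padding both sides with zeros covers `m ≤ n` and `n
≤ m` at once. -/
theorem roots_charpoly_dilation (X : Matrix (Fin m) (Fin n) ℝ) :
    (dilation X).charpoly.roots.map (fun x => x ^ 2) + n • {0} =
      2 • (wishart X).charpoly.roots + m • {0} := by
  have h1 : (dilation X * dilation X).charpoly =
      (wishart X).charpoly * ((m : ℝ)⁻¹ • (X * Xᵀ)).charpoly := by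
    rw [dilation_mul_self, charpoly_fromBlocks_zero₁₂]
  have h2 := charpoly_mul_comm' (((m : ℝ)⁻¹) • X) Xᵀ
  rw [Matrix.smul_mul, Matrix.mul_smul, Fintype.card_fin, Fintype.card_fin] at h2
  change _ = _ * (wishart X).charpoly at h2
  have h3 := congrArg Polynomial.roots h2
  have e1 := (charpoly_monic (wishart X)).ne_zero
  have e2 := (charpoly_monic ((m : ℝ)⁻¹ • (X * Xᵀ))).ne_zero
  rw [Polynomial.roots_mul (mul_ne_zero (pow_ne_zero _ Polynomial.X_ne_zero) e2),
    Polynomial.roots_mul (mul_ne_zero (pow_ne_zero _ Polynomial.X_ne_zero) e1),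
    Polynomial.roots_X_pow, Polynomial.roots_X_pow] at h3
  rw [← roots_charpoly_mul_self (dilation_isHermitian X), h1,
    Polynomial.roots_mul (mul_ne_zero e1 e2), add_assoc, add_comm _ (n • {0}), h3, two_nsmul]
  abel

theorem sum_eigenvalues_dilation (X : Matrix (Fin m) (Fin n) ℝ) (f : ℝ → ℝ) :
    ∑ i, f ((dilation_isHermitian X).eigenvalues i ^ 2) + n * f 0 =
      2 * ∑ i, f ((wishart_isHermitian X).eigenvalues i) + m * f 0 := by
  have h := congrArg (fun s : Multiset ℝ => (s.map f).sum) (roots_charpoly_dilation X)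
  rw [sum_eigenvalues_eq_roots (dilation_isHermitian X) (fun x => f (x ^ 2)),
    sum_eigenvalues_eq_roots (wishart_isHermitian X)]
  simpa [Multiset.map_nsmul, Multiset.sum_nsmul] using h

theorem spectralIntegral_wishart_eq (hn : 0 < n) (X : Matrix (Fin m) (Fin n) ℝ) (f : ℝ → ℝ) :
    spectralIntegral (wishart_isHermitian X) f =
      (2 * n : ℝ)⁻¹ * (∑ i, f ((dilation_isHermitian X).eigenvalues i ^ 2) + (n - m) * f 0) := by
  have h := sum_eigenvalues_dilation X f
  have hn' : (n : ℝ) ≠ 0 := by positivity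
  rw [spectralIntegral]
  field_simp
  linarith

theorem convexOn_spectralIntegral_wishart (hn : 0 < n) {f : ℝ → ℝ}
    (hf : ConvexOn ℝ Set.univ fun x : ℝ => f (x ^ 2)) :
    ConvexOn ℝ Set.univ fun X : Matrix (Fin m) (Fin n) ℝ =>
      spectralIntegral (wishart_isHermitian X) f := by
  refine ⟨convex_univ, fun X _ Y _ a b ha hb hab => ?_⟩
  simp only [spectralIntegral_wishart_eq hn, smul_eq_mul]
  have h := sum_convex_eigenvalues_convex (dilation_isHermitian X) (dilation_isHermitian Y)
    (dilation_isHermitian (a • X + b • Y)) hf ha hb hab (by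
      simp only [dilation]
      rw [smul_comm a, smul_comm b, ← smul_add, fromBlocks_smul a, fromBlocks_smul b,
        fromBlocks_add]
      simp)
  calc _ ≤ (2 * n : ℝ)⁻¹ * (a * ∑ i, f ((dilation_isHermitian X).eigenvalues i ^ 2) +
        b * ∑ i, f ((dilation_isHermitian Y).eigenvalues i ^ 2) + (a + b) * ((n - m) * f 0)) := by
        rw [hab, one_mul]; gcongr
    _ = _ := by ring

theorem abs_spectralIntegral_wishart_sub_le (hn : 0 < n) {f : ℝ → ℝ}
    (hf : ConvexOn ℝ Set.univ fun x : ℝ => f (x ^ 2)) {L : ℝ} (hL : 0 ≤ L)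
    (hfL : ∀ x y : ℝ, |f (x ^ 2) - f (y ^ 2)| ≤ L * |x - y|) (X Y : Matrix (Fin m) (Fin n) ℝ) :
    |spectralIntegral (wishart_isHermitian X) f - spectralIntegral (wishart_isHermitian Y) f| ≤
      L * √((n + m) / (2 * n ^ 2 * m)) * √(∑ i, ∑ j, (X i j - Y i j) ^ 2) := by
  have h := abs_sum_convex_eigenvalues_sub_le (dilation_isHermitian X) (dilation_isHermitian Y)
    hf hL hfL
  -- The factor 2 arises because each entry of `X` occurs twice in the dilation.
  have e : ∑ i, ∑ j, (dilation X i j - dilation Y i j) ^ 2 =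
      (2 / m) * ∑ i, ∑ j, (X i j - Y i j) ^ 2 := by
    have hm : ((√(m : ℝ))⁻¹) ^ 2 = (m : ℝ)⁻¹ := by
      rw [inv_pow, Real.sq_sqrt (by positivity)]
    simp only [dilation, Fintype.sum_sum_type, Matrix.smul_apply, fromBlocks_apply₁₁,
      fromBlocks_apply₁₂, fromBlocks_apply₂₁, fromBlocks_apply₂₂, transpose_apply, Matrix.zero_apply, smul_eq_mul,
      sub_self, ← mul_sub, mul_pow, hm, ← Finset.mul_sum]
    have hc : ∑ j, ∑ i, (X i j - Y i j) ^ 2 = ∑ i, ∑ j, (X i j - Y i j) ^ 2 := Finset.sum_comm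
    simp only [Finset.sum_add_distrib, hc]
    simp
    ring
  rw [e] at h
  rw [spectralIntegral_wishart_eq hn, spectralIntegral_wishart_eq hn, ← mul_sub, abs_mul,
    abs_of_pos (by positivity : (0 : ℝ) < (2 * n : ℝ)⁻¹), add_sub_add_right_eq_sub]
  refine (mul_le_mul_of_nonneg_left h (by positivity)).trans (le_of_eq ?_)
  have h4 : (2 * n : ℝ)⁻¹ = √((2 * n : ℝ)⁻¹ ^ 2) := (Real.sqrt_sq (by positivity)).symm
  rw [h4, mul_left_comm, mul_assoc L, ← Real.sqrt_mul (by positivity),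
    ← Real.sqrt_mul (by positivity), ← Real.sqrt_mul (by positivity)]
  congr 2
  simp
  ring

end Dilation

/-! ### Maurey's inequality on one factor -/

section ConvexTransport

/-- The Taylor terms up to order two add up to exactly 2, and the cubic term `-s³` absorbs the
quartic term and both remainders on `[0, 1/2]`. -/
theorem exp_sub_sq_add_exp_neg_le {s : ℝ} (h0 : 0 ≤ s) (h1 : s ≤ 1 / 2) :
    Real.exp (s - s ^ 2) + Real.exp (-s) ≤ 2 := by
  have hu0 : 0 ≤ s - s ^ 2 := by nlinarith
  have hus : s - s ^ 2 ≤ s := by nlinarith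
  have a := Real.exp_bound' hu0 (by linarith) (n := 3) (by norm_num)
  have b := Real.exp_bound (x := -s) (by rw [abs_neg, abs_of_nonneg h0]; linarith) (n := 3)
    (by norm_num)
  have b' := (abs_le.1 b).2
  rw [abs_neg, abs_of_nonneg h0] at b'
  norm_num [Finset.sum_range_succ, Nat.factorial] at a b'
  have c : (s - s ^ 2) ^ 3 ≤ s ^ 3 := pow_le_pow_left₀ hu0 hus 3
  have d : s ^ 4 ≤ s ^ 3 / 2 := by nlinarith [pow_nonneg h0 3]
  nlinarith [pow_nonneg h0 3]

/-- The optimisation step in Talagrand's induction. -/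
theorem exists_exp_interpolation_le {s : ℝ} (h0 : 0 ≤ s) :
    ∃ θ : ℝ, 0 ≤ θ ∧ θ ≤ 1 ∧ Real.exp ((1 - θ) * s + θ ^ 2 / 4) ≤ 2 - Real.exp (-s) := by
  rcases le_total s (1 / 2) with h | h
  -- `θ = 2s` minimises the exponent. Beyond `s = 1/2` this minimiser leaves `[0, 1]`; at `θ = 1`
  -- the left side no longer depends on `s` while the right side increases.
  · refine ⟨2 * s, by linarith, by linarith, ?_⟩
    have := exp_sub_sq_add_exp_neg_le h0 h
    rw [show (1 - 2 * s) * s + (2 * s) ^ 2 / 4 = s - s ^ 2 by ring]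
    linarith
  · refine ⟨1, by norm_num, le_rfl, ?_⟩
    have h2 := exp_sub_sq_add_exp_neg_le (s := 1 / 2) (by norm_num) le_rfl
    have h3 : Real.exp (-s) ≤ Real.exp (-(1 / 2)) := Real.exp_le_exp.2 (by linarith)
    rw [show (1 / 2 : ℝ) - (1 / 2) ^ 2 = (1 - 1) * s + 1 ^ 2 / 4 by ring] at h2
    linarith

variable {E : Type*} [NormedAddCommGroup E]

/-- Infimal convolution with the quadratic cost `κ ‖·‖²`. -/
noncomputable def quadInfConv (κ : ℝ) (f : E → ℝ) (x : E) : ℝ := ⨅ y, (f y + κ * ‖x - y‖ ^ 2)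

theorem quadInfConv_le {κ : ℝ} (hκ : 0 ≤ κ) {f : E → ℝ} (hf : ∀ x, 0 ≤ f x) (x y : E) :
    quadInfConv κ f x ≤ f y + κ * ‖x - y‖ ^ 2 :=
  ciInf_le ⟨0, by rintro _ ⟨z, rfl⟩; have := hf z; positivity⟩ y

theorem quadInfConv_nonneg {κ : ℝ} (hκ : 0 ≤ κ) {f : E → ℝ} (hf : ∀ x, 0 ≤ f x) (x : E) :
    0 ≤ quadInfConv κ f x :=
  le_ciInf fun z => by have := hf z; positivity

variable [NormedSpace ℝ E]

/-- Move `x` a fraction `θ` of the way towards a near-minimiser of `f` on `B`: convexity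
interpolates the values of `f`, and the move costs at most `θ²/4`. Then optimise over `θ`. -/
theorem exp_quadInfConv_le {κ : ℝ} (hκ : 0 ≤ κ) {B : Set E}
    (hB : ∀ x ∈ B, ∀ y ∈ B, κ * ‖x - y‖ ^ 2 ≤ 1 / 4) {f : E → ℝ} (hf : ∀ x, 0 ≤ f x)
    (hc : ConvexOn ℝ Set.univ f) {x : E} (hx : x ∈ B) :
    Real.exp (quadInfConv κ f x) ≤
      Real.exp (sInf (f '' B)) * (2 - Real.exp (-(f x - sInf (f '' B)))) := by
  have hbdd : BddBelow (f '' B) := ⟨0, by rintro _ ⟨z, _, rfl⟩; exact hf z⟩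
  set M := sInf (f '' B) with hM
  have hMx : M ≤ f x := csInf_le hbdd ⟨x, hx, rfl⟩
  obtain ⟨θ, h0, h1, hθ⟩ := exists_exp_interpolation_le (s := f x - M) (by linarith)
  have key (y : E) (hy : y ∈ B) :
      quadInfConv κ f x ≤ (1 - θ) * f x + θ * f y + θ ^ 2 / 4 := by
    refine (quadInfConv_le hκ hf x ((1 - θ) • x + θ • y)).trans ?_
    have e1 := hc.2 (Set.mem_univ x) (Set.mem_univ y) (sub_nonneg.2 h1) h0 (by ring)
    have e2 : x - ((1 - θ) • x + θ • y) = θ • (x - y) := by module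
    rw [e2, norm_smul, mul_pow, Real.norm_eq_abs, sq_abs]
    have e3 := mul_le_mul_of_nonneg_left (hB x hx y hy) (sq_nonneg θ)
    simp only [smul_eq_mul] at e1
    linarith
  -- The infimum `M` need not be attained, so `key` is solved for `f y` before passing to the
  -- infimum; this divides by `θ`, hence the separate case `θ = 0`.
  have key2 : quadInfConv κ f x ≤ (1 - θ) * f x + θ * M + θ ^ 2 / 4 := by
    rcases h0.eq_or_lt with h | h
    · have := key x hx
      rw [← h] at this ⊢
      linarith
    · have : (quadInfConv κ f x - (1 - θ) * f x - θ ^ 2 / 4) / θ ≤ M := by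
        refine le_csInf ⟨_, x, hx, rfl⟩ ?_
        rintro _ ⟨y, hy, rfl⟩
        rw [div_le_iff₀ h]
        linarith [key y hy]
      rw [div_le_iff₀ h] at this
      linarith
  calc Real.exp (quadInfConv κ f x)
      ≤ Real.exp (M + ((1 - θ) * (f x - M) + θ ^ 2 / 4)) :=
        Real.exp_le_exp.2 (by linarith)
    _ ≤ _ := by rw [Real.exp_add]; gcongr

variable [MeasurableSpace E]

theorem integrable_exp_quadInfConv {κ : ℝ} (hκ : 0 ≤ κ) {B : Set E}
    (hB : ∀ x ∈ B, ∀ y ∈ B, κ * ‖x - y‖ ^ 2 ≤ 1 / 4) {f : E → ℝ} (hf : ∀ x, 0 ≤ f x)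
    (hc : ConvexOn ℝ Set.univ f) (hq : Measurable (quadInfConv κ f))
    (ν : Measure E) [IsProbabilityMeasure ν] (hν : ∀ᵐ x ∂ν, x ∈ B) :
    Integrable (fun x => Real.exp (quadInfConv κ f x)) ν := by
  refine Integrable.of_bound (C := Real.exp (sInf (f '' B)) * 2)
    hq.exp.aestronglyMeasurable ?_
  filter_upwards [hν] with x hx
  rw [Real.norm_eq_abs, abs_of_pos (Real.exp_pos _)]
  refine (exp_quadInfConv_le hκ hB hf hc hx).trans ?_
  gcongr
  linarith [Real.exp_pos (-(f x - sInf (f '' B)))]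

/-- Maurey's convex infimum-convolution inequality on a single factor. -/
theorem integral_exp_quadInfConv_mul_le {κ : ℝ} (hκ : 0 ≤ κ) {B : Set E}
    (hB : ∀ x ∈ B, ∀ y ∈ B, κ * ‖x - y‖ ^ 2 ≤ 1 / 4) {f : E → ℝ} (hf : ∀ x, 0 ≤ f x)
    (hc : ConvexOn ℝ Set.univ f) (hfm : Measurable f) (hq : Measurable (quadInfConv κ f))
    (ν : Measure E) [IsProbabilityMeasure ν] (hν : ∀ᵐ x ∂ν, x ∈ B) :
    (∫ x, Real.exp (quadInfConv κ f x) ∂ν) * ∫ x, Real.exp (-f x) ∂ν ≤ 1 := by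
  set M := sInf (f '' B) with hM
  set a := ∫ x, Real.exp (-(f x - M)) ∂ν with ha
  have hbdd : BddBelow (f '' B) := ⟨0, by rintro _ ⟨z, _, rfl⟩; exact hf z⟩
  have hint : Integrable (fun x => Real.exp (-(f x - M))) ν := by
    refine Integrable.of_bound (C := 1) (by fun_prop) ?_
    filter_upwards [hν] with x hx
    rw [Real.norm_eq_abs, abs_of_pos (Real.exp_pos _), Real.exp_le_one_iff]
    linarith [csInf_le hbdd ⟨x, hx, rfl⟩]
  have h1 : ∫ x, Real.exp (quadInfConv κ f x) ∂ν ≤ Real.exp M * (2 - a) := by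
    calc ∫ x, Real.exp (quadInfConv κ f x) ∂ν
        ≤ ∫ x, Real.exp M * (2 - Real.exp (-(f x - M))) ∂ν := by
          refine integral_mono_ae (integrable_exp_quadInfConv hκ hB hf hc hq ν hν)
            (((integrable_const _).sub hint).const_mul _) ?_
          filter_upwards [hν] with x hx using exp_quadInfConv_le hκ hB hf hc hx
      _ = _ := by
          rw [integral_const_mul, integral_sub (integrable_const _) hint]
          simp [ha]
  have h2 : ∫ x, Real.exp (-f x) ∂ν = Real.exp (-M) * a := by
    rw [ha, ← integral_const_mul]
    congr 1 with x
    rw [← Real.exp_add]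
    ring_nf
  have ha0 : 0 ≤ a := integral_nonneg fun x => (Real.exp_pos _).le
  rw [h2]
  calc _ ≤ (Real.exp M * (2 - a)) * (Real.exp (-M) * a) := by gcongr
    _ = (2 - a) * a := by
        have : Real.exp M * Real.exp (-M) = 1 := by rw [← Real.exp_add]; simp
        linear_combination (2 - a) * a * this
    _ ≤ 1 := by nlinarith [sq_nonneg (a - 1)]

end ConvexTransport

/-! ### Partial infimal convolution and its logarithmic Laplace transform -/

section Partial

variable {E V : Type*} [NormedAddCommGroup E] [NormedSpace ℝ E]
  [NormedAddCommGroup V] [NormedSpace ℝ V]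

/-- A partial infimum of a jointly convex function is convex; here the function is `F` plus the
convex cost. -/
theorem convexOn_quadInfConv_fst {κ : ℝ} (hκ : 0 ≤ κ) {F : E × V → ℝ} (hF : ∀ p, 0 ≤ F p)
    (hc : ConvexOn ℝ Set.univ F) :
    ConvexOn ℝ Set.univ fun p : E × V => quadInfConv κ (fun z => F (z, p.2)) p.1 := by
  refine ⟨convex_univ, fun p _ r _ a b ha hb hab => ?_⟩
  simp only [smul_eq_mul]
  have key (z w : E) : quadInfConv κ (fun z => F (z, (a • p + b • r).2)) (a • p + b • r).1 ≤
      a * (F (z, p.2) + κ * ‖p.1 - z‖ ^ 2) + b * (F (w, r.2) + κ * ‖r.1 - w‖ ^ 2) := by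
    refine (quadInfConv_le hκ (fun _ => hF _) _ (a • z + b • w)).trans ?_
    have e1 := hc.2 (Set.mem_univ (z, p.2)) (Set.mem_univ (w, r.2)) ha hb hab
    have e2 : (a • p + b • r).1 - (a • z + b • w) = a • (p.1 - z) + b • (r.1 - w) := by
      simp only [Prod.fst_add, Prod.smul_fst]; module
    have e3 : ‖a • (p.1 - z) + b • (r.1 - w)‖ ≤ a * ‖p.1 - z‖ + b * ‖r.1 - w‖ := by
      refine (norm_add_le _ _).trans (le_of_eq ?_)
      rw [norm_smul, norm_smul, Real.norm_of_nonneg ha, Real.norm_of_nonneg hb]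
    have e4 : (a * ‖p.1 - z‖ + b * ‖r.1 - w‖) ^ 2 ≤ a * ‖p.1 - z‖ ^ 2 + b * ‖r.1 - w‖ ^ 2 := by
      have := (convexOn_pow (𝕜 := ℝ) 2).2 (norm_nonneg (p.1 - z)) (norm_nonneg (r.1 - w)) ha hb hab
      simpa using this
    have e5 := mul_le_mul_of_nonneg_left
      ((pow_le_pow_left₀ (norm_nonneg _) e3 2).trans e4) hκ
    rw [e2]
    simp only [smul_eq_mul, Prod.smul_mk, Prod.mk_add_mk] at e1
    simp only [Prod.snd_add, Prod.smul_snd]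
    linarith
  set t := quadInfConv κ (fun z => F (z, (a • p + b • r).2)) (a • p + b • r).1
  have h1 (w : E) : t ≤ a * quadInfConv κ (fun z => F (z, p.2)) p.1 +
      b * (F (w, r.2) + κ * ‖r.1 - w‖ ^ 2) := by
    rw [quadInfConv, Real.mul_iInf_of_nonneg ha, ← sub_le_iff_le_add]
    exact le_ciInf fun z => by linarith [key z w]
  rw [quadInfConv.eq_1 κ (fun z => F (z, r.2)), Real.mul_iInf_of_nonneg hb,
    ← sub_le_iff_le_add']
  exact le_ciInf fun w => by linarith [h1 w]

/-- Convexity of the log-Laplace functional, that is, Hölder's inequality. Once both integrals are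
normalised to 1, it is the pointwise convexity of `exp`. -/
theorem integral_exp_convexComb_le {α : Type*} [MeasurableSpace α] {ν : Measure α}
    {u v w : α → ℝ} {a b : ℝ} (ha : 0 ≤ a) (hb : 0 ≤ b) (hab : a + b = 1)
    (hu : Integrable (fun x => Real.exp (u x)) ν) (hv : Integrable (fun x => Real.exp (v x)) ν)
    (hw : Integrable (fun x => Real.exp (w x)) ν) (hle : ∀ x, w x ≤ a * u x + b * v x)
    (hw0 : 0 < ∫ x, Real.exp (w x) ∂ν)
    (hu0 : 0 < ∫ x, Real.exp (u x) ∂ν) (hv0 : 0 < ∫ x, Real.exp (v x) ∂ν) :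
    Real.log (∫ x, Real.exp (w x) ∂ν) ≤
      a * Real.log (∫ x, Real.exp (u x) ∂ν) + b * Real.log (∫ x, Real.exp (v x) ∂ν) := by
  set A := ∫ x, Real.exp (u x) ∂ν
  set B := ∫ x, Real.exp (v x) ∂ν
  have hpt (x : α) : Real.exp (w x) ≤ Real.exp (a * Real.log A + b * Real.log B) *
      (a * (A⁻¹ * Real.exp (u x)) + b * (B⁻¹ * Real.exp (v x))) := by
    have hA : A⁻¹ * Real.exp (u x) = Real.exp (u x - Real.log A) := by
      rw [Real.exp_sub, Real.exp_log hu0]; ring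
    have hB : B⁻¹ * Real.exp (v x) = Real.exp (v x - Real.log B) := by
      rw [Real.exp_sub, Real.exp_log hv0]; ring
    have := convexOn_exp.2 (Set.mem_univ (u x - Real.log A)) (Set.mem_univ (v x - Real.log B))
      ha hb hab
    simp only [smul_eq_mul] at this
    rw [hA, hB]
    calc Real.exp (w x) ≤ Real.exp (a * Real.log A + b * Real.log B) *
          Real.exp (a * (u x - Real.log A) + b * (v x - Real.log B)) := by
          rw [← Real.exp_add]
          exact Real.exp_le_exp.2 (by linarith [hle x])
      _ ≤ _ := by gcongr
  rw [Real.log_le_iff_le_exp hw0]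
  calc ∫ x, Real.exp (w x) ∂ν ≤ ∫ x, Real.exp (a * Real.log A + b * Real.log B) *
      (a * (A⁻¹ * Real.exp (u x)) + b * (B⁻¹ * Real.exp (v x))) ∂ν :=
        integral_mono hw (((hu.const_mul _).const_mul _ |>.add
          ((hv.const_mul _).const_mul _)).const_mul _) hpt
    _ = _ := by
        rw [integral_const_mul, integral_add ((hu.const_mul _).const_mul _)
          ((hv.const_mul _).const_mul _)]
        simp only [integral_const_mul]
        change _ * (a * (A⁻¹ * A) + b * (B⁻¹ * B)) = _
        rw [inv_mul_cancel₀ hu0.ne', inv_mul_cancel₀ hv0.ne', mul_one, mul_one, hab, mul_one]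

variable [FiniteDimensional ℝ E] [FiniteDimensional ℝ V]

theorem _root_.ConvexOn.continuous_of_univ {f : E → ℝ} (hf : ConvexOn ℝ Set.univ f) :
    Continuous f :=
  continuousOn_univ.1 (hf.continuousOn isOpen_univ)

variable [MeasurableSpace E] [BorelSpace E]

/-- The logarithmic Laplace transform in the first variable of the partial infimal convolution
of `F`. -/
noncomputable def partialLogIntegral (κ : ℝ) (ν : Measure E) (F : E × V → ℝ) (y : V) : ℝ :=
  Real.log (∫ x, Real.exp (quadInfConv κ (fun z => F (z, y)) x) ∂ν)

/-- What the induction over factors needs: the function left after eliminating one variable is again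
convex and nonnegative, and the one-factor inequality bounds the integral of `exp (-F)` over that
variable. -/
theorem partialLogIntegral_spec {κ : ℝ} (hκ : 0 ≤ κ) {B : Set E}
    (hB : ∀ x ∈ B, ∀ y ∈ B, κ * ‖x - y‖ ^ 2 ≤ 1 / 4) {ν : Measure E} [IsProbabilityMeasure ν]
    (hν : ∀ᵐ x ∂ν, x ∈ B) {F : E × V → ℝ} (hF : ∀ p, 0 ≤ F p) (hc : ConvexOn ℝ Set.univ F) :
    ConvexOn ℝ Set.univ (partialLogIntegral κ ν F) ∧
    (∀ y, 0 ≤ partialLogIntegral κ ν F y) ∧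
    (∀ y, ∫⁻ x, ENNReal.ofReal (Real.exp (quadInfConv κ (fun z => F (z, y)) x)) ∂ν =
      ENNReal.ofReal (Real.exp (partialLogIntegral κ ν F y))) ∧
    (∀ y, ∫⁻ x, ENNReal.ofReal (Real.exp (-F (x, y))) ∂ν ≤
      ENNReal.ofReal (Real.exp (-partialLogIntegral κ ν F y))) := by
  have hsec (y : V) : ConvexOn ℝ Set.univ fun z : E => F (z, y) := by
    refine ⟨convex_univ, fun z _ w _ a b ha hb hab => ?_⟩
    have := hc.2 (Set.mem_univ (z, y)) (Set.mem_univ (w, y)) ha hb hab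
    simpa [← add_smul, hab] using this
  have hqc := convexOn_quadInfConv_fst hκ hF hc
  have hqm (y : V) : Measurable (quadInfConv κ fun z => F (z, y)) :=
    (hqc.continuous_of_univ.comp (Continuous.prodMk_left y)).measurable
  have hint (y : V) : Integrable (fun x => Real.exp (quadInfConv κ (fun z => F (z, y)) x)) ν :=
    integrable_exp_quadInfConv hκ hB (fun _ => hF _) (hsec y) (hqm y) ν hν
  have hone (y : V) : 1 ≤ ∫ x, Real.exp (quadInfConv κ (fun z => F (z, y)) x) ∂ν := by
    calc (1 : ℝ) = ∫ _, (1 : ℝ) ∂ν := by simp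
      _ ≤ _ := integral_mono (integrable_const _) (hint y) fun x =>
        Real.one_le_exp (quadInfConv_nonneg hκ (fun _ => hF _) x)
  have hpos (y : V) : 0 < ∫ x, Real.exp (quadInfConv κ (fun z => F (z, y)) x) ∂ν :=
    one_pos.trans_le (hone y)
  refine ⟨⟨convex_univ, fun y _ w _ a b ha hb hab => ?_⟩, fun y => Real.log_nonneg (hone y),
    fun y => ?_, fun y => ?_⟩
  · refine integral_exp_convexComb_le ha hb hab (hint y) (hint w) (hint _) (fun x => ?_)
      (hpos _) (hpos _) (hpos _)
    have := hqc.2 (Set.mem_univ (x, y)) (Set.mem_univ (x, w)) ha hb hab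
    simpa [← add_smul, hab] using this
  · rw [← ofReal_integral_eq_lintegral_ofReal (hint y)
      (Filter.Eventually.of_forall fun _ => (Real.exp_pos _).le), partialLogIntegral,
      Real.exp_log (hpos y)]
  · have hFm : Measurable fun z => F (z, y) :=
      (hc.continuous_of_univ.comp (Continuous.prodMk_left y)).measurable
    have hFi : Integrable (fun x => Real.exp (-F (x, y))) ν := by
      refine Integrable.of_bound (C := 1) hFm.neg.exp.aestronglyMeasurable (Filter.Eventually.of_forall fun x => ?_)
      rw [Real.norm_eq_abs, abs_of_pos (Real.exp_pos _), Real.exp_le_one_iff]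
      linarith [hF (x, y)]
    rw [← ofReal_integral_eq_lintegral_ofReal hFi
      (Filter.Eventually.of_forall fun _ => (Real.exp_pos _).le)]
    refine ENNReal.ofReal_le_ofReal ?_
    rw [Real.exp_neg, partialLogIntegral, Real.exp_log (hpos y), ← one_div, le_div_iff₀ (hpos y),
      mul_comm]
    exact integral_exp_quadInfConv_mul_le hκ hB (fun _ => hF _) (hsec y) hFm (hqm y) ν hν

theorem le_ofReal_exp_iInf_add {ι : Type*} [Nonempty ι] {G : ENNReal} {t : ι → ℝ} {c : ℝ}
    (h : ∀ i, G ≤ ENNReal.ofReal (Real.exp (t i + c))) :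
    G ≤ ENNReal.ofReal (Real.exp ((⨅ i, t i) + c)) := by
  obtain ⟨i₀⟩ := ‹Nonempty ι›
  have hG : G ≠ ⊤ := ne_top_of_le_ne_top ENNReal.ofReal_ne_top (h i₀)
  lift G to ℝ≥0 using hG
  rcases eq_or_ne G 0 with rfl | h0
  · simp
  have hp : 0 < (G : ℝ) := by positivity
  have h' (i : ι) : Real.log G - c ≤ t i := by
    have := (ENNReal.le_ofReal_iff_toReal_le ENNReal.coe_ne_top (Real.exp_pos _).le).1 (h i)
    rw [ENNReal.coe_toReal, ← Real.log_le_iff_le_exp hp] at this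
    linarith
  rw [ENNReal.le_ofReal_iff_toReal_le ENNReal.coe_ne_top (Real.exp_pos _).le, ENNReal.coe_toReal,
    ← Real.log_le_iff_le_exp hp]
  have : Nonempty ι := ⟨i₀⟩
  linarith [le_ciInf h']

end Partial

/-! ### Tensorisation of Maurey's inequality -/

section Product

variable {E : Type*} [MeasurableSpace E]

theorem measurable_fin_cons {m : ℕ} :
    Measurable fun p : (Fin m → E) × E => (Fin.cons p.2 p.1 : Fin (m + 1) → E) := by
  refine measurable_pi_iff.2 fun i => ?_
  refine Fin.cases ?_ (fun j => ?_) i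
  · simpa using measurable_snd
  · simpa using! (measurable_pi_apply j).comp measurable_fst

theorem lintegral_pi_fin_succ {m : ℕ} (ν : Fin (m + 1) → Measure E)
    [∀ i, IsProbabilityMeasure (ν i)] {G : (Fin (m + 1) → E) → ENNReal} (hG : Measurable G) :
    ∫⁻ x, G x ∂Measure.pi ν =
      ∫⁻ y, ∫⁻ x, G (Fin.cons x y) ∂ν 0 ∂Measure.pi fun i => ν (Fin.succ i) := by
  have h := (measurePreserving_piFinSuccAbove ν 0).symm
  rw [← h.lintegral_comp hG]
  refine (lintegral_prod_symm' (fun p : E × (Fin m → E) =>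
    G ((MeasurableEquiv.piFinSuccAbove (fun _ => E) 0).symm p))
    (hG.comp (MeasurableEquiv.measurable _))).trans ?_
  simp [MeasurableEquiv.piFinSuccAbove, Fin.insertNthEquiv]

variable [NormedAddCommGroup E] [NormedSpace ℝ E] [FiniteDimensional ℝ E] [BorelSpace E]

/-- **Maurey's convex infimum-convolution inequality** for product measures. -/
theorem lintegral_mul_lintegral_exp_neg_le {κ : ℝ} (hκ : 0 ≤ κ) {B : Set E}
    (hB : ∀ x ∈ B, ∀ y ∈ B, κ * ‖x - y‖ ^ 2 ≤ 1 / 4) {m : ℕ} (ν : Fin m → Measure E)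
    [∀ i, IsProbabilityMeasure (ν i)] (hν : ∀ i, ∀ᵐ x ∂ν i, x ∈ B) {f : (Fin m → E) → ℝ}
    (hf : ∀ x, 0 ≤ f x) (hc : ConvexOn ℝ Set.univ f) {G : (Fin m → E) → ENNReal}
    (hG : Measurable G)
    -- `G` is any measurable minorant of the exponential of the infimal convolution. This form is
    -- stable under integrating out a coordinate and lets indicators be inserted directly.
    (hGf : ∀ x y, G x ≤ ENNReal.ofReal (Real.exp (f y + κ * ∑ i, ‖x i - y i‖ ^ 2))) :
    (∫⁻ x, G x ∂Measure.pi ν) * ∫⁻ x, ENNReal.ofReal (Real.exp (-f x)) ∂Measure.pi ν ≤ 1 := by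
  induction m with
  | zero =>
    rw [Measure.pi_of_empty ν 0, lintegral_dirac, lintegral_dirac]
    refine (mul_le_mul_left (hGf 0 0) _).trans ?_
    rw [← ENNReal.ofReal_mul (Real.exp_pos _).le, ← Real.exp_add]
    simp
  | succ m ih =>
    set F : E × (Fin m → E) → ℝ := fun p => f (Fin.cons p.1 p.2) with hFdef
    have hF0 (p) : 0 ≤ F p := hf _
    have hFc : ConvexOn ℝ Set.univ F := by
      refine ⟨convex_univ, fun p _ r _ a b ha hb hab => ?_⟩
      have := hc.2 (Set.mem_univ (Fin.cons p.1 p.2)) (Set.mem_univ (Fin.cons r.1 r.2)) ha hb hab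
      refine le_trans (le_of_eq ?_) this
      simp only [hFdef]
      congr 1
      ext i
      refine Fin.cases ?_ (fun j => ?_) i <;> simp
    have hfm : Measurable f := hc.continuous_of_univ.measurable
    obtain ⟨h1, h2, h3, h4⟩ := partialLogIntegral_spec hκ hB (hν 0) hF0 hFc
    have hGm : Measurable fun y => ∫⁻ x, G (Fin.cons x y) ∂ν 0 :=
      (hG.comp measurable_fin_cons).lintegral_prod_right'
    -- Integrated over the first coordinate, `G` satisfies the same domination on the remaining
    -- ones, with `partialLogIntegral` in place of `f`.
    have := ih (fun i => ν i.succ) (fun i => hν i.succ) h2 h1 hGm (fun y w => by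
      calc ∫⁻ x, G (Fin.cons x y) ∂ν 0
          ≤ ∫⁻ x, ENNReal.ofReal (Real.exp (quadInfConv κ (fun z => F (z, w)) x)) *
              ENNReal.ofReal (Real.exp (κ * ∑ i, ‖y i - w i‖ ^ 2)) ∂ν 0 := by
            refine lintegral_mono fun x => ?_
            rw [← ENNReal.ofReal_mul (Real.exp_pos _).le, ← Real.exp_add]
            refine le_ofReal_exp_iInf_add fun z => ?_
            refine (hGf (Fin.cons x y) (Fin.cons z w)).trans (le_of_eq ?_)
            rw [Fin.sum_univ_succ]
            simp [hFdef, mul_add, add_assoc]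
        _ = _ := by
            rw [lintegral_mul_const' _ _ ENNReal.ofReal_ne_top, h3,
              ← ENNReal.ofReal_mul (Real.exp_pos _).le, ← Real.exp_add])
    rw [lintegral_pi_fin_succ ν hG, lintegral_pi_fin_succ ν (by fun_prop)]
    refine le_trans ?_ this
    gcongr with y
    exact h4 y

end Product

/-! ### Tails and Laplace transforms of convex Lipschitz functions -/

section ConvexConcentration

variable {E : Type*} [MeasurableSpace E] [NormedAddCommGroup E] [NormedSpace ℝ E]
  [FiniteDimensional ℝ E] [BorelSpace E]

/-- Maurey's inequality for a multiple of `(F - M)₊`, which vanishes where `F ≤ M`, while its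
infimal convolution is at least `κt²/Λ²` where `F ≥ M + t`. -/
theorem measure_le_mul_measure_ge_le {κ : ℝ} (hκ : 0 ≤ κ) {B : Set E}
    (hB : ∀ x ∈ B, ∀ y ∈ B, κ * ‖x - y‖ ^ 2 ≤ 1 / 4) {m : ℕ} (ν : Fin m → Measure E)
    [∀ i, IsProbabilityMeasure (ν i)] (hν : ∀ i, ∀ᵐ x ∂ν i, x ∈ B) {F : (Fin m → E) → ℝ}
    (hc : ConvexOn ℝ Set.univ F) {Λ : ℝ} (hΛ : 0 < Λ)
    (hF : ∀ x y, |F x - F y| ≤ Λ * √(∑ i, ‖x i - y i‖ ^ 2)) (M : ℝ) {t : ℝ} (ht : 0 < t) :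
    (Measure.pi ν).real {x | F x ≤ M} * (Measure.pi ν).real {x | M + t ≤ F x} ≤
      Real.exp (-(κ * t ^ 2 / Λ ^ 2)) := by
  have hFm : Measurable F := hc.continuous_of_univ.measurable
  -- This slope maximises `a t - a²Λ²/(4κ)`, the minimum over `r` of `a(t - Λr) + κr²`.
  set a := 2 * κ * t / Λ ^ 2 with ha
  have ha0 : 0 ≤ a := by positivity
  set f : (Fin m → E) → ℝ := fun x => a * max (F x - M) 0 with hf
  have hfc : ConvexOn ℝ Set.univ f := by
    have h1 : ConvexOn ℝ Set.univ fun x => F x - M := by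
      simpa [sub_eq_add_neg] using! hc.add_const (-M)
    exact (h1.sup (convexOn_const 0 convex_univ)).smul ha0
  set s := κ * t ^ 2 / Λ ^ 2 with hs
  have hms : MeasurableSet {x | M + t ≤ F x} := measurableSet_le measurable_const hFm
  have key := lintegral_mul_lintegral_exp_neg_le hκ hB ν hν (f := f) (fun x => by positivity) hfc
    (G := Set.indicator {x | M + t ≤ F x} fun _ => ENNReal.ofReal (Real.exp s))
    (measurable_const.indicator hms) (fun x y => by
      by_cases hx : x ∈ {x | M + t ≤ F x}
      · rw [Set.indicator_of_mem hx]
        refine ENNReal.ofReal_le_ofReal (Real.exp_le_exp.2 ?_)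
        have hx' : M + t ≤ F x := hx
        set r := √(∑ i, ‖x i - y i‖ ^ 2) with hr
        have hr2 : ∑ i, ‖x i - y i‖ ^ 2 = r ^ 2 := (Real.sq_sqrt (by positivity)).symm
        have h1 := (abs_le.1 (hF x y)).2
        rw [hr2]
        calc s ≤ a * (t - Λ * r) + κ * r ^ 2 := by
              have : a * (t - Λ * r) + κ * r ^ 2 - s = κ * (t / Λ - r) ^ 2 := by
                rw [ha, hs]; field_simp; ring
              have h2 : 0 ≤ κ * (t / Λ - r) ^ 2 := by positivity
              linarith
          _ ≤ _ := by
              have h3 : t - Λ * r ≤ max (F y - M) 0 := le_max_of_le_left (by linarith)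
              exact add_le_add_left (mul_le_mul_of_nonneg_left h3 ha0) _
      · rw [Set.indicator_of_notMem hx]; exact zero_le)
  rw [lintegral_indicator_const hms] at key
  have h2 : Measure.pi ν {x | F x ≤ M} ≤
      ∫⁻ x, ENNReal.ofReal (Real.exp (-f x)) ∂Measure.pi ν := by
    have hm2 : MeasurableSet {x | F x ≤ M} := measurableSet_le hFm measurable_const
    rw [← lintegral_indicator_one hm2]
    refine lintegral_mono fun x => ?_
    by_cases hx : x ∈ {x | F x ≤ M}
    · have hx' : F x - M ≤ 0 := sub_nonpos.2 hx
      simp [Set.indicator_of_mem hx, hf, max_eq_right hx']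
    · rw [Set.indicator_of_notMem hx]; exact zero_le
  have h3 := (mul_le_mul_right h2 _).trans key
  have h4 := ENNReal.toReal_mono ENNReal.one_ne_top h3
  rw [ENNReal.toReal_mul, ENNReal.toReal_mul, ENNReal.toReal_ofReal (Real.exp_pos _).le,
    ENNReal.toReal_one] at h4
  rw [Real.exp_neg, ← one_div, le_div_iff₀ (Real.exp_pos _)]
  simp only [Measure.real]
  linarith

/-- Infimal convolution lowers `aF` by at most the maximum of `aΛr - κr²` over `r`, which is
`a²Λ²/(4κ)`. The lower bound `b` only serves to make the function nonnegative and cancels. -/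
theorem lintegral_exp_mul_lintegral_exp_neg_le {κ : ℝ} (hκ : 0 < κ) {B : Set E}
    (hB : ∀ x ∈ B, ∀ y ∈ B, κ * ‖x - y‖ ^ 2 ≤ 1 / 4) {m : ℕ} (ν : Fin m → Measure E)
    [∀ i, IsProbabilityMeasure (ν i)] (hν : ∀ i, ∀ᵐ x ∂ν i, x ∈ B) {F : (Fin m → E) → ℝ}
    (hc : ConvexOn ℝ Set.univ F) {Λ : ℝ}
    (hF : ∀ x y, |F x - F y| ≤ Λ * √(∑ i, ‖x i - y i‖ ^ 2)) {b : ℝ} (hb : ∀ x, b ≤ F x)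
    {a : ℝ} (ha : 0 ≤ a) :
    (∫⁻ x, ENNReal.ofReal (Real.exp (a * F x)) ∂Measure.pi ν) *
      ∫⁻ x, ENNReal.ofReal (Real.exp (-(a * F x))) ∂Measure.pi ν ≤
      ENNReal.ofReal (Real.exp (a ^ 2 * Λ ^ 2 / (4 * κ))) := by
  have hFm : Measurable F := hc.continuous_of_univ.measurable
  have hfc : ConvexOn ℝ Set.univ fun x => a * (F x - b) := by
    have h1 : ConvexOn ℝ Set.univ fun x => F x - b := by
      simpa [sub_eq_add_neg] using! hc.add_const (-b)
    exact h1.smul ha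
  set s := a ^ 2 * Λ ^ 2 / (4 * κ) with hs
  have key := lintegral_mul_lintegral_exp_neg_le hκ.le hB ν hν (f := fun x => a * (F x - b))
    (fun x => mul_nonneg ha (sub_nonneg.2 (hb x))) hfc
    (G := fun x => ENNReal.ofReal (Real.exp (-(a * b) - s)) *
      ENNReal.ofReal (Real.exp (a * F x))) (by fun_prop) (fun x y => by
        rw [← ENNReal.ofReal_mul (Real.exp_pos _).le, ← Real.exp_add]
        refine ENNReal.ofReal_le_ofReal (Real.exp_le_exp.2 ?_)
        set r := √(∑ i, ‖x i - y i‖ ^ 2) with hr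
        have hr2 : ∑ i, ‖x i - y i‖ ^ 2 = r ^ 2 := (Real.sq_sqrt (by positivity)).symm
        have h1 := mul_le_mul_of_nonneg_left (abs_le.1 (hF x y)).2 ha
        rw [hr2]
        have h2 : s - a * (Λ * r) + κ * r ^ 2 = κ * (a * Λ / (2 * κ) - r) ^ 2 := by
          rw [hs]; field_simp; ring
        have h3 : 0 ≤ κ * (a * Λ / (2 * κ) - r) ^ 2 := by positivity
        linarith)
  rw [lintegral_const_mul _ (by fun_prop)] at key
  have h2 : ∫⁻ x, ENNReal.ofReal (Real.exp (-(a * (F x - b)))) ∂Measure.pi ν =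
      ENNReal.ofReal (Real.exp (a * b)) *
        ∫⁻ x, ENNReal.ofReal (Real.exp (-(a * F x))) ∂Measure.pi ν := by
    rw [← lintegral_const_mul _ (by fun_prop)]
    refine lintegral_congr fun x => ?_
    rw [← ENNReal.ofReal_mul (Real.exp_pos _).le, ← Real.exp_add]
    ring_nf
  rw [h2] at key
  have h5 : ENNReal.ofReal (Real.exp s) * (ENNReal.ofReal (Real.exp (-(a * b) - s)) *
      ENNReal.ofReal (Real.exp (a * b))) = 1 := by
    rw [← ENNReal.ofReal_mul (Real.exp_pos _).le, ← ENNReal.ofReal_mul (Real.exp_pos _).le,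
      ← Real.exp_add, ← Real.exp_add]
    simp [show s + (-(a * b) - s + a * b) = 0 by ring]
  have h6 := mul_le_mul_right key (ENNReal.ofReal (Real.exp s))
  rw [mul_one] at h6
  refine le_trans (le_of_eq ?_) h6
  conv_lhs => rw [← one_mul (_ * _), ← h5]
  ring

end ConvexConcentration

/-! ### From symmetrised Laplace transforms to sub-Gaussian tails -/

section SubGaussian

variable {Ω : Type*} [MeasurableSpace Ω] {μ : Measure Ω} [IsProbabilityMeasure μ]

theorem measureReal_abs_sub_integral_ge_le {T : Ω → ℝ} {c : ℝ≥0}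
    (h : HasSubgaussianMGF (fun ω => T ω - ∫ ω', T ω' ∂μ) c μ) {ε : ℝ} (hε : 0 ≤ ε) :
    μ.real {ω | ε ≤ |T ω - ∫ ω', T ω' ∂μ|} ≤ 2 * Real.exp (-ε ^ 2 / (2 * c)) := by
  have h1 := h.measure_ge_le hε
  have h2 := h.neg.measure_ge_le hε
  have hsub : {ω | ε ≤ |T ω - ∫ ω', T ω' ∂μ|} ⊆ {ω | ε ≤ T ω - ∫ ω', T ω' ∂μ} ∪
      {ω | ε ≤ (-fun ω => T ω - ∫ ω', T ω' ∂μ) ω} := by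
    intro ω hω
    rcases le_abs.1 (show ε ≤ |T ω - ∫ ω', T ω' ∂μ| from hω) with h | h
    · exact Or.inl h
    · exact Or.inr h
  have := (measureReal_mono (μ := μ) hsub).trans (measureReal_union_le _ _)
  linarith

/-- By Jensen the centring factor `exp (-a E T)` is at most `E exp (-aT)`, so the centred transform
is bounded by the product. The parameter is `2v` because sub-Gaussianity with parameter `c` means
the bound `exp (c a²/2)`. -/
theorem hasSubgaussianMGF_of_integral_exp_mul_le {T : Ω → ℝ} (hT : Measurable T) {C : ℝ}
    (hC : ∀ᵐ ω ∂μ, |T ω| ≤ C) {v : ℝ≥0}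
    (h : ∀ a : ℝ, 0 ≤ a → (∫ ω, Real.exp (a * T ω) ∂μ) * ∫ ω, Real.exp (-(a * T ω)) ∂μ ≤
      Real.exp (a ^ 2 * v)) :
    HasSubgaussianMGF (fun ω => T ω - ∫ ω', T ω' ∂μ) (2 * v) μ := by
  set e := ∫ ω', T ω' ∂μ with he
  have hTi : Integrable T μ := Integrable.of_bound hT.aestronglyMeasurable C hC
  have hint (a : ℝ) : Integrable (fun ω => Real.exp (a * T ω)) μ := by
    refine Integrable.of_bound (by fun_prop) (Real.exp (|a| * C)) ?_
    filter_upwards [hC] with ω hω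
    rw [Real.norm_eq_abs, abs_of_pos (Real.exp_pos _)]
    refine Real.exp_le_exp.2 ((le_abs_self _).trans ?_)
    rw [abs_mul]
    gcongr
  have hJ (a : ℝ) : Real.exp (a * e) ≤ ∫ ω, Real.exp (a * T ω) ∂μ := by
    rw [he, ← integral_const_mul]
    exact convexOn_exp.map_integral_le Real.continuous_exp.continuousOn isClosed_univ
      (Filter.Eventually.of_forall fun _ => Set.mem_univ _) (hTi.const_mul a) (hint a)
  have hshift (a : ℝ) (ω : Ω) : Real.exp (a * (T ω - e)) =
      Real.exp (-(a * e)) * Real.exp (a * T ω) := by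
    rw [← Real.exp_add]; ring_nf
  have hprod (a : ℝ) : (∫ ω, Real.exp (a * T ω) ∂μ) * ∫ ω, Real.exp (-a * T ω) ∂μ ≤
      Real.exp (a ^ 2 * v) := by
    rcases le_total 0 a with h0 | h0
    · simpa only [neg_mul] using h a h0
    · have := h (-a) (neg_nonneg.2 h0)
      rw [mul_comm, neg_sq] at this
      simpa only [neg_mul, neg_neg] using this
  refine ⟨fun a => ?_, fun a => ?_⟩
  · simp only [hshift]
    exact (hint a).const_mul _
  · have h0 : 0 ≤ ∫ ω, Real.exp (a * T ω) ∂μ := integral_nonneg fun _ => (Real.exp_pos _).le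
    rw [mgf]
    simp only [hshift]
    rw [integral_const_mul]
    calc Real.exp (-(a * e)) * ∫ ω, Real.exp (a * T ω) ∂μ
        ≤ (∫ ω, Real.exp (-a * T ω) ∂μ) * ∫ ω, Real.exp (a * T ω) ∂μ := by
          gcongr
          simpa only [neg_mul] using hJ (-a)
      _ ≤ _ := by
          rw [mul_comm]
          refine (hprod a).trans (le_of_eq ?_)
          push_cast
          ring_nf

end SubGaussian

/-! ### McDiarmid's inequality -/

section BoundedDifferences

variable {E : Type*} [MeasurableSpace E]

theorem integral_pi_fin_succ {m : ℕ} (ν : Fin (m + 1) → Measure E)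
    [∀ i, IsProbabilityMeasure (ν i)] {G : (Fin (m + 1) → E) → ℝ}
    (hG : Integrable G (Measure.pi ν)) :
    ∫ x, G x ∂Measure.pi ν =
      ∫ y, ∫ x, G (Fin.cons x y) ∂ν 0 ∂Measure.pi fun i => ν (Fin.succ i) := by
  have h := (measurePreserving_piFinSuccAbove ν 0).symm
  rw [← h.integral_comp' G]
  refine (integral_prod_symm (fun p : E × (Fin m → E) =>
    G ((MeasurableEquiv.piFinSuccAbove (fun _ => E) 0).symm p))
    (h.integrable_comp_of_integrable hG)).trans ?_
  simp [MeasurableEquiv.piFinSuccAbove, Fin.insertNthEquiv]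

/-- Hoeffding's lemma: an oscillation of at most `d` places the values in an interval of length `d`.
-/
theorem integral_exp_mul_sub_integral_le {ν : Measure E} [IsProbabilityMeasure ν] {T : E → ℝ}
    (hT : Measurable T) {d : ℝ} (hd : 0 ≤ d) (h : ∀ x y, |T x - T y| ≤ d) (t : ℝ) :
    ∫ x, Real.exp (t * (T x - ∫ x', T x' ∂ν)) ∂ν ≤ Real.exp (d ^ 2 * t ^ 2 / 8) := by
  have : Nonempty E := ν.nonempty_of_neZero
  obtain ⟨x₀⟩ := this
  have hbdd : BddBelow (Set.range T) :=
    ⟨T x₀ - d, by rintro _ ⟨x, rfl⟩; linarith [(abs_le.1 (h x₀ x)).2]⟩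
  set a := sInf (Set.range T)
  have hmem (x : E) : T x ∈ Set.Icc a (a + d) := by
    refine ⟨csInf_le hbdd ⟨x, rfl⟩, ?_⟩
    have : T x - d ≤ a := by
      refine le_csInf ⟨_, x, rfl⟩ ?_
      rintro _ ⟨y, rfl⟩
      linarith [(abs_le.1 (h x y)).2]
    linarith
  have := (hasSubgaussianMGF_of_mem_Icc (μ := ν) hT.aemeasurable
    (Filter.Eventually.of_forall hmem)).mgf_le t
  rw [mgf] at this
  refine this.trans (le_of_eq ?_)
  congr 1
  push_cast
  rw [add_sub_cancel_left, Real.norm_of_nonneg hd]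
  ring

/-- Average out the first coordinate: the fluctuation around the average is handled by Hoeffding's
lemma, and the average inherits differences at most `d`, so the induction hypothesis applies to it.
-/
theorem integral_exp_mul_sub_integral_pi_le {m : ℕ} (ν : Fin m → Measure E)
    [∀ i, IsProbabilityMeasure (ν i)] {T : (Fin m → E) → ℝ} (hT : Measurable T) {C : ℝ}
    (hC : ∀ x, |T x| ≤ C) {d : ℝ} (hd : 0 ≤ d)
    (h : ∀ x i z, |T x - T (Function.update x i z)| ≤ d) (t : ℝ) :
    ∫ x, Real.exp (t * (T x - ∫ x', T x' ∂Measure.pi ν)) ∂Measure.pi ν ≤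
      Real.exp (m * d ^ 2 * t ^ 2 / 8) := by
  induction m generalizing C with
  | zero =>
    rw [Measure.pi_of_empty ν finZeroElim, integral_dirac, integral_dirac]
    simp
  | succ m ih =>
    have hTc (y : Fin m → E) : Measurable fun x => T (Fin.cons x y) :=
      hT.comp (measurable_fin_cons.comp (measurable_const.prodMk measurable_id))
    have hTi (y : Fin m → E) : Integrable (fun x => T (Fin.cons x y)) (ν 0) :=
      Integrable.of_bound (hTc y).aestronglyMeasurable C
        (Filter.Eventually.of_forall fun _ => hC _)
    have hTI : Integrable T (Measure.pi ν) :=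
      Integrable.of_bound hT.aestronglyMeasurable C (Filter.Eventually.of_forall hC)
    set g : (Fin m → E) → ℝ := fun y => ∫ x, T (Fin.cons x y) ∂ν 0 with hg
    have hgm : Measurable g :=
      ((hT.comp measurable_fin_cons).stronglyMeasurable.integral_prod_right').measurable
    have hgC (y) : |g y| ≤ C := by
      have := norm_integral_le_of_norm_le_const (μ := ν 0) (C := C)
        (f := fun x => T (Fin.cons x y)) (Filter.Eventually.of_forall fun x => hC (Fin.cons x y))
      simpa using this
    have hgd (y : Fin m → E) (i z) : |g y - g (Function.update y i z)| ≤ d := by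
      rw [hg, ← integral_sub (hTi _) (hTi _)]
      have := norm_integral_le_of_norm_le_const (μ := ν 0) (C := d)
        (f := fun x => T (Fin.cons x y) - T (Fin.cons x (Function.update y i z)))
        (Filter.Eventually.of_forall fun x => by
          rw [Fin.cons_update]
          exact h _ _ _)
      simpa using this
    have hE : ∫ x', T x' ∂Measure.pi ν = ∫ y, g y ∂Measure.pi fun i => ν (Fin.succ i) :=
      integral_pi_fin_succ ν hTI
    set e := ∫ x', T x' ∂Measure.pi ν
    have hIH := ih (fun i => ν i.succ) hgm hgC hgd
    rw [← hE] at hIH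
    have hexp : Integrable (fun x => Real.exp (t * (T x - e))) (Measure.pi ν) := by
      refine Integrable.of_bound (by fun_prop) (Real.exp (|t| * (C + |e|)))
        (Filter.Eventually.of_forall fun x => ?_)
      rw [Real.norm_eq_abs, abs_of_pos (Real.exp_pos _)]
      refine Real.exp_le_exp.2 ((le_abs_self _).trans ?_)
      rw [abs_mul]
      gcongr
      exact (abs_sub _ _).trans (by linarith [hC x])
    have hexpg : Integrable (fun y => Real.exp (t * (g y - e)))
        (Measure.pi fun i => ν (Fin.succ i)) := by
      refine Integrable.of_bound (by fun_prop) (Real.exp (|t| * (C + |e|)))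
        (Filter.Eventually.of_forall fun x => ?_)
      rw [Real.norm_eq_abs, abs_of_pos (Real.exp_pos _)]
      refine Real.exp_le_exp.2 ((le_abs_self _).trans ?_)
      rw [abs_mul]
      gcongr
      exact (abs_sub _ _).trans (by linarith [hgC x])
    rw [integral_pi_fin_succ ν hexp]
    calc (∫ y, ∫ x, Real.exp (t * (T (Fin.cons x y) - e)) ∂ν 0 ∂Measure.pi fun i => ν i.succ)
        ≤ ∫ y, Real.exp (d ^ 2 * t ^ 2 / 8) * Real.exp (t * (g y - e))
            ∂Measure.pi fun i => ν i.succ := by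
          refine integral_mono_of_nonneg
            (Filter.Eventually.of_forall fun y => integral_nonneg fun _ => (Real.exp_pos _).le)
            (hexpg.const_mul _) (Filter.Eventually.of_forall fun y => ?_)
          have e1 (x : E) : Real.exp (t * (T (Fin.cons x y) - e)) =
              Real.exp (t * (T (Fin.cons x y) - g y)) * Real.exp (t * (g y - e)) := by
            rw [← Real.exp_add]; ring_nf
          simp only [e1]
          rw [integral_mul_const]
          gcongr
          refine integral_exp_mul_sub_integral_le (hTc y) hd (fun x z => ?_) t
          have := h (Fin.cons x y) 0 z
          rwa [Fin.update_cons_zero] at this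
      _ ≤ _ := by
          rw [integral_const_mul]
          refine (mul_le_mul_of_nonneg_left hIH (Real.exp_pos _).le).trans (le_of_eq ?_)
          rw [← Real.exp_add]
          push_cast
          ring_nf

/-- **McDiarmid's bounded differences inequality**, in moment generating function form. -/
theorem hasSubgaussianMGF_pi_of_bounded_differences {m : ℕ} (ν : Fin m → Measure E)
    [∀ i, IsProbabilityMeasure (ν i)] {T : (Fin m → E) → ℝ} (hT : Measurable T) {C : ℝ}
    (hC : ∀ x, |T x| ≤ C) {d : ℝ≥0}
    (h : ∀ x i z, |T x - T (Function.update x i z)| ≤ d) :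
    HasSubgaussianMGF (fun x => T x - ∫ x', T x' ∂Measure.pi ν) (m * d ^ 2 / 4)
      (Measure.pi ν) := by
  refine ⟨fun t => ?_, fun t => ?_⟩
  · refine Integrable.of_bound (by fun_prop) (Real.exp (|t| * (C + |∫ x', T x' ∂Measure.pi ν|)))
      (Filter.Eventually.of_forall fun x => ?_)
    rw [Real.norm_eq_abs, abs_of_pos (Real.exp_pos _)]
    refine Real.exp_le_exp.2 ((le_abs_self _).trans ?_)
    rw [abs_mul]
    gcongr
    exact (abs_sub _ _).trans (by linarith [hC x])
  · refine (integral_exp_mul_sub_integral_pi_le ν hT hC d.coe_nonneg h t).trans (le_of_eq ?_)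
    congr 1
    push_cast
    ring

end BoundedDifferences

/-! ### Eigenvalue counting and interlacing -/

section Interlacing

open Matrix

variable {ι : Type*} [Fintype ι] [DecidableEq ι]

theorem dotProduct_mulVec_sub_eq_sum {A : Matrix ι ι ℝ} (hA : A.IsHermitian)
    (x : EuclideanSpace ℝ ι) (t : ℝ) :
    x.ofLp ⬝ᵥ A *ᵥ x.ofLp - t * ‖x‖ ^ 2 =
      ∑ j, (hA.eigenvalues j - t) * (inner ℝ (hA.eigenvectorBasis j) x) ^ 2 := by
  have h := hA.eigenvectorBasis.sum_sq_norm_inner_right x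
  simp only [Real.norm_eq_abs, sq_abs] at h
  rw [dotProduct_mulVec_eq_sum_eigenvalues hA, ← h, Finset.mul_sum, ← Finset.sum_sub_distrib]
  exact Finset.sum_congr rfl fun j _ => by ring

/-- If the quadratic form of `B` is dominated by that of `A` on a hyperplane, then `B` has at most
one eigenvalue fewer than `A` in `(-∞, t]`. -/
theorem card_eigenvalues_le_le_succ {A B : Matrix ι ι ℝ} (hA : A.IsHermitian) (hB : B.IsHermitian)
    (a : ι → ℝ) (h : ∀ x : ι → ℝ, a ⬝ᵥ x = 0 → x ⬝ᵥ B *ᵥ x ≤ x ⬝ᵥ A *ᵥ x) (t : ℝ) :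
    (Finset.univ.filter fun i => hA.eigenvalues i ≤ t).card ≤
      (Finset.univ.filter fun i => hB.eigenvalues i ≤ t).card + 1 := by
  by_contra! hlt
  set v := hA.eigenvectorBasis
  set w := hB.eigenvectorBasis
  -- A kernel vector lies on the hyperplane, in the span of the eigenvectors of `A` with eigenvalue
  -- at most `t`, and in that of the eigenvectors of `B` with eigenvalue above `t`. If the counts
  -- differed by more than one, there would be fewer constraints than dimensions; a nonzero such
  -- vector has `A`-form at most `t‖x‖²` and `B`-form above it.
  let φ : EuclideanSpace ℝ ι →ₗ[ℝ] ({i // hB.eigenvalues i ≤ t} → ℝ) ×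
      ({i // ¬ hA.eigenvalues i ≤ t} → ℝ) × ℝ :=
    (LinearMap.pi fun j => (innerSL ℝ (w j.1)).toLinearMap).prod
      ((LinearMap.pi fun j => (innerSL ℝ (v j.1)).toLinearMap).prod
        (innerSL ℝ (WithLp.toLp 2 a)).toLinearMap)
  have hcard := Finset.card_filter_add_card_filter_not (s := (Finset.univ : Finset ι))
    (fun i => hA.eigenvalues i ≤ t)
  have hrank : Module.finrank ℝ (({i // hB.eigenvalues i ≤ t} → ℝ) ×
      ({i // ¬ hA.eigenvalues i ≤ t} → ℝ) × ℝ) < Module.finrank ℝ (EuclideanSpace ℝ ι) := by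
    rw [Module.finrank_prod, Module.finrank_prod, finrank_euclideanSpace, Module.finrank_pi,
      Module.finrank_pi, Module.finrank_self, Fintype.card_subtype, Fintype.card_subtype]
    rw [Finset.card_univ] at hcard
    omega
  obtain ⟨x, hx, hx0⟩ := (Submodule.ne_bot_iff _).1
    (LinearMap.ker_ne_bot_of_finrank_lt (f := φ) hrank)
  rw [LinearMap.mem_ker] at hx
  have h1 (j) (hj : hB.eigenvalues j ≤ t) : inner ℝ (w j) x = 0 :=
    congrFun (congrArg Prod.fst hx) ⟨j, hj⟩
  have h2 (j) (hj : ¬ hA.eigenvalues j ≤ t) : inner ℝ (v j) x = 0 :=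
    congrFun (congrArg (fun p => p.2.1) hx) ⟨j, hj⟩
  have h3 : inner ℝ (WithLp.toLp 2 a) x = 0 := congrArg (fun p => p.2.2) hx
  have h4 : a ⬝ᵥ x.ofLp = 0 := by
    rw [EuclideanSpace.inner_eq_star_dotProduct, dotProduct_comm] at h3
    simpa using h3
  have h5 := h x.ofLp h4
  have h6 : x.ofLp ⬝ᵥ A *ᵥ x.ofLp - t * ‖x‖ ^ 2 ≤ 0 := by
    rw [dotProduct_mulVec_sub_eq_sum hA]
    refine Finset.sum_nonpos fun j _ => ?_
    by_cases hj : hA.eigenvalues j ≤ t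
    · exact mul_nonpos_of_nonpos_of_nonneg (by linarith) (sq_nonneg _)
    · have := h2 j hj
      simp [v] at this
      simp [this]
  have h7 : 0 < x.ofLp ⬝ᵥ B *ᵥ x.ofLp - t * ‖x‖ ^ 2 := by
    rw [dotProduct_mulVec_sub_eq_sum hB]
    obtain ⟨j, hj⟩ : ∃ j, inner ℝ (w j) x ≠ 0 := by
      by_contra! hall
      have := w.sum_sq_norm_inner_right x
      simp only [hall, norm_zero] at this
      simp at this
      exact hx0 (by simpa using this.symm)
    refine Finset.sum_pos' (fun k _ => ?_) ⟨j, Finset.mem_univ _, ?_⟩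
    · by_cases hk : hB.eigenvalues k ≤ t
      · have := h1 k hk
        simp only [w] at this
        simp [this]
      · exact mul_nonneg (by linarith) (sq_nonneg _)
    · have hk : ¬ hB.eigenvalues j ≤ t := fun hk => hj (h1 j hk)
      exact mul_pos (by linarith) (by positivity)
  linarith

theorem card_eigenvalues_le_eq {A : Matrix ι ι ℝ} (hA : A.IsHermitian) (t : ℝ) :
    (Finset.univ.filter fun i => hA.eigenvalues i ≤ t).card =
      (Finset.univ.filter fun k => hA.eigenvalues₀ k ≤ t).card :=
  Finset.card_equiv (Fintype.equivOfCardEq (Fintype.card_fin _)).symm (by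
    intro i
    simp only [Finset.mem_filter, Finset.mem_univ, true_and]
    rfl)

theorem sum_eigenvalues_eq_sum_eigenvalues₀ {A : Matrix ι ι ℝ} (hA : A.IsHermitian) (f : ℝ → ℝ) :
    ∑ i, f (hA.eigenvalues i) = ∑ k, f (hA.eigenvalues₀ k) :=
  Fintype.sum_equiv (Fintype.equivOfCardEq (Fintype.card_fin _)).symm _ _ fun _ => rfl

/-- `eigenvalues₀` is decreasing and indexed from 0, so the indices with value at most `t` form a
final segment. -/
theorem eigenvalues₀_le_iff {A : Matrix ι ι ℝ} (hA : A.IsHermitian) (t : ℝ)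
    (k : Fin (Fintype.card ι)) :
    hA.eigenvalues₀ k ≤ t ↔
      Fintype.card ι ≤ k + (Finset.univ.filter fun i => hA.eigenvalues i ≤ t).card := by
  rw [card_eigenvalues_le_eq]
  constructor
  · intro hk
    have : Finset.Ici k ⊆ Finset.univ.filter fun k => hA.eigenvalues₀ k ≤ t := by
      intro l hl
      simpa using (hA.eigenvalues₀_antitone (Finset.mem_Ici.1 hl)).trans hk
    have := Finset.card_le_card this
    rw [Fin.card_Ici] at this
    omega
  · intro hk
    by_contra! hlt
    have : (Finset.univ.filter fun k => hA.eigenvalues₀ k ≤ t) ⊆ Finset.Ioi k := by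
      intro l hl
      rw [Finset.mem_Ioi]
      by_contra! hle
      have h1 := hA.eigenvalues₀_antitone hle
      have h2 := (Finset.mem_filter.1 hl).2
      linarith
    have := Finset.card_le_card this
    rw [Fin.card_Ioi] at this
    have := k.2
    omega

theorem eigenvalues₀_le_of_card_le {A B : Matrix ι ι ℝ} (hA : A.IsHermitian) (hB : B.IsHermitian)
    (h : ∀ t, (Finset.univ.filter fun i => hA.eigenvalues i ≤ t).card ≤
      (Finset.univ.filter fun i => hB.eigenvalues i ≤ t).card + 1)
    {i j : Fin (Fintype.card ι)} (hij : i < j) : hB.eigenvalues₀ j ≤ hA.eigenvalues₀ i := by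
  rw [eigenvalues₀_le_iff]
  have h1 := (eigenvalues₀_le_iff hA _ i).1 le_rfl
  have h2 := h (hA.eigenvalues₀ i)
  have h3 : (i : ℕ) < j := hij
  omega

end Interlacing

/-! ### Bounded variation along interlacing sequences -/

section Variation

theorem sum_sub_le_of_nested {N : ℕ} {p q : Fin N → ℝ} {U : ℝ} (hU : 0 ≤ U) (hp : ∀ i, p i ≤ U)
    (hq : ∀ i, 0 ≤ q i) (h : ∀ i j, i < j → p j ≤ q i) : ∑ i, (p i - q i) ≤ U := by
  induction N generalizing U with
  | zero => simpa using hU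
  | succ N ih =>
    rw [Fin.sum_univ_succ]
    -- All later `p i` lie below `q 0`, so `q 0` is the new upper bound and the sum telescopes.
    have := ih (p := fun i => p i.succ) (q := fun i => q i.succ) (hq 0)
      (fun i => h 0 i.succ (Fin.succ_pos i)) (fun i => hq _)
      (fun i j hij => h _ _ (Fin.succ_lt_succ_iff.2 hij))
    linarith [hp 0]

theorem abs_sub_le_eVariationOn_Iic_sub {f : ℝ → ℝ} (hf : BoundedVariationOn f Set.univ) {x y : ℝ}
    (hxy : x ≤ y) :
    |f x - f y| ≤ (eVariationOn f (Set.Iic y)).toReal - (eVariationOn f (Set.Iic x)).toReal := by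
  have hfin (s : Set ℝ) : eVariationOn f s ≠ ⊤ := hf.mono (Set.subset_univ s)
  have h1 : eVariationOn f (Set.Iic x) + eVariationOn f (Set.Icc x y) ≤
      eVariationOn f (Set.Iic y) := by
    have := eVariationOn.add_le_union f (s := Set.Iic x) (t := Set.Icc x y)
      (fun a ha b hb => le_trans ha hb.1)
    rwa [Set.Iic_union_Icc_eq_Iic hxy] at this
  have h2 := ENNReal.toReal_mono (hfin _) h1
  rw [ENNReal.toReal_add (hfin _) (hfin _)] at h2
  have h3 : dist (f x) (f y) ≤ (eVariationOn f (Set.Icc x y)).toReal :=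
    BoundedVariationOn.dist_le (hfin _) (Set.left_mem_Icc.2 hxy) (Set.right_mem_Icc.2 hxy)
  rw [Real.dist_eq] at h3
  linarith

/-- Interlacing makes the intervals between `a i` and `b i` non-overlapping. Each increment of `f`
is at most the increment of `x ↦ Var(f, (-∞, x])` over its interval, and these increments add up to
at most the total variation. -/
theorem sum_abs_sub_le_totalVariation {f : ℝ → ℝ} (hf : BoundedVariationOn f Set.univ) {N : ℕ}
    {a b : Fin N → ℝ} (ha : Antitone a) (hb : Antitone b) (hab : ∀ i j, i < j → b j ≤ a i)
    (hba : ∀ i j, i < j → a j ≤ b i) : ∑ i, |f (a i) - f (b i)| ≤ totalVariation f := by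
  have hfin (s : Set ℝ) : eVariationOn f s ≠ ⊤ := hf.mono (Set.subset_univ s)
  have hmono {x y : ℝ} (hxy : x ≤ y) : (eVariationOn f (Set.Iic x)).toReal ≤
      (eVariationOn f (Set.Iic y)).toReal :=
    ENNReal.toReal_mono (hfin _) (eVariationOn.mono f (Set.Iic_subset_Iic.2 hxy))
  calc ∑ i, |f (a i) - f (b i)|
      ≤ ∑ i, ((eVariationOn f (Set.Iic (max (a i) (b i)))).toReal -
          (eVariationOn f (Set.Iic (min (a i) (b i)))).toReal) := by
        refine Finset.sum_le_sum fun i _ => ?_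
        rcases le_total (a i) (b i) with h | h
        · rw [max_eq_right h, min_eq_left h]
          exact abs_sub_le_eVariationOn_Iic_sub hf h
        · rw [max_eq_left h, min_eq_right h, abs_sub_comm]
          exact abs_sub_le_eVariationOn_Iic_sub hf h
    _ ≤ totalVariation f := by
        refine sum_sub_le_of_nested ENNReal.toReal_nonneg
          (fun i => ENNReal.toReal_mono (hfin _) (eVariationOn.mono f (Set.subset_univ _)))
          (fun i => ENNReal.toReal_nonneg) fun i j hij => hmono ?_
        exact max_le (le_min (ha hij.le) (hba i j hij)) (le_min (hab i j hij) (hb hij.le))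

theorem _root_.BoundedVariationOn.measurable {f : ℝ → ℝ} (hf : BoundedVariationOn f Set.univ) :
    Measurable f := by
  obtain ⟨p, q, hp, hq, rfl⟩ :=
    hf.locallyBoundedVariationOn.exists_monotoneOn_sub_monotoneOn
  exact (monotoneOn_univ.1 hp).measurable.sub (monotoneOn_univ.1 hq).measurable

end Variation

/-! ### Effect of replacing one row -/

section Rows

open Matrix

variable {m n : ℕ}

theorem dotProduct_wishart_mulVec (X : Matrix (Fin m) (Fin n) ℝ) (x : Fin n → ℝ) :
    x ⬝ᵥ wishart X *ᵥ x = (m : ℝ)⁻¹ * ∑ i, (X i ⬝ᵥ x) ^ 2 := by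
  rw [wishart, smul_mulVec, dotProduct_smul, ← mulVec_mulVec, dotProduct_mulVec,
    ← mulVec_transpose, transpose_transpose, smul_eq_mul]
  congr 1
  simp only [dotProduct, sq, mulVec]

/-- On the hyperplane orthogonal to the new row `z`, that row contributes nothing, so the new form
is at most the old one. -/
theorem card_eigenvalues_wishart_updateRow (X : Matrix (Fin m) (Fin n) ℝ) (i : Fin m)
    (z : Fin n → ℝ) (t : ℝ) :
    (Finset.univ.filter fun j => (wishart_isHermitian X).eigenvalues j ≤ t).card ≤
      (Finset.univ.filter fun j =>
        (wishart_isHermitian (X.updateRow i z)).eigenvalues j ≤ t).card + 1 := by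
  refine card_eigenvalues_le_le_succ _ _ z (fun x hx => ?_) t
  rw [dotProduct_wishart_mulVec, dotProduct_wishart_mulVec]
  refine mul_le_mul_of_nonneg_left (Finset.sum_le_sum fun k _ => ?_) (by positivity)
  rcases eq_or_ne k i with rfl | hk
  · simp [hx]
    positivity
  · rw [updateRow_ne hk]

/-- The roles are exchanged by putting the old row back. -/
theorem card_eigenvalues_updateRow_wishart (X : Matrix (Fin m) (Fin n) ℝ) (i : Fin m)
    (z : Fin n → ℝ) (t : ℝ) :
    (Finset.univ.filter fun j =>
        (wishart_isHermitian (X.updateRow i z)).eigenvalues j ≤ t).card ≤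
      (Finset.univ.filter fun j => (wishart_isHermitian X).eigenvalues j ≤ t).card + 1 := by
  have := card_eigenvalues_wishart_updateRow (X.updateRow i z) i (X i) t
  rw [updateRow_idem] at this
  simpa only [updateRow_eq_self] using this

theorem abs_spectralCDF_sub_updateRow_le (X : Matrix (Fin m) (Fin n) ℝ) (i : Fin m)
    (z : Fin n → ℝ) (t : ℝ) :
    |spectralCDF (wishart_isHermitian X) t -
      spectralCDF (wishart_isHermitian (X.updateRow i z)) t| ≤ (n : ℝ)⁻¹ := by
  have h1 := card_eigenvalues_wishart_updateRow X i z t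
  have h2 := card_eigenvalues_updateRow_wishart X i z t
  rw [spectralCDF, spectralCDF, ← mul_sub, abs_mul, abs_of_nonneg (by positivity : 0 ≤ (n : ℝ)⁻¹)]
  refine mul_le_of_le_one_right (by positivity) ?_
  rw [abs_le]
  constructor
  · rw [neg_le_sub_iff_le_add]
    exact_mod_cast h2
  · rw [sub_le_iff_le_add']
    exact_mod_cast h1

theorem abs_spectralIntegral_sub_updateRow_le {f : ℝ → ℝ} (hf : BoundedVariationOn f Set.univ)
    (X : Matrix (Fin m) (Fin n) ℝ) (i : Fin m) (z : Fin n → ℝ) :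
    |spectralIntegral (wishart_isHermitian X) f -
      spectralIntegral (wishart_isHermitian (X.updateRow i z)) f| ≤
      (n : ℝ)⁻¹ * totalVariation f := by
  rw [spectralIntegral, spectralIntegral, ← mul_sub, abs_mul,
    abs_of_nonneg (by positivity : 0 ≤ (n : ℝ)⁻¹)]
  gcongr
  rw [sum_eigenvalues_eq_sum_eigenvalues₀, sum_eigenvalues_eq_sum_eigenvalues₀,
    ← Finset.sum_sub_distrib]
  refine (Finset.abs_sum_le_sum_abs _ _).trans ?_
  exact sum_abs_sub_le_totalVariation hf (IsHermitian.eigenvalues₀_antitone _)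
    (IsHermitian.eigenvalues₀_antitone _)
    (fun _ _ h => eigenvalues₀_le_of_card_le _ _ (card_eigenvalues_wishart_updateRow X i z) h)
    (fun _ _ h => eigenvalues₀_le_of_card_le _ _ (card_eigenvalues_updateRow_wishart X i z) h)

theorem abs_spectralIntegral_le {f : ℝ → ℝ} {C : ℝ} (hC : 0 ≤ C) (hf : ∀ x, |f x| ≤ C)
    {A : Matrix (Fin n) (Fin n) ℝ} (hA : A.IsHermitian) : |spectralIntegral hA f| ≤ C := by
  rw [spectralIntegral, abs_mul, abs_of_nonneg (by positivity : 0 ≤ (n : ℝ)⁻¹)]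
  calc (n : ℝ)⁻¹ * |∑ i, f (hA.eigenvalues i)| ≤ (n : ℝ)⁻¹ * ∑ _i : Fin n, C := by
        gcongr
        exact (Finset.abs_sum_le_sum_abs _ _).trans (Finset.sum_le_sum fun i _ => hf _)
    _ = ((n : ℝ)⁻¹ * n) * C := by simp [mul_assoc]
    _ ≤ C := mul_le_of_le_one_left hC (inv_mul_le_one)

end Rows

/-! ### Measurability of eigenvalues -/

section Measurability

open Filter Topology Matrix

variable {m n : ℕ}

theorem continuous_sum_convex_eigenvalues_wishart {g : ℝ → ℝ} (hg : ConvexOn ℝ Set.univ g) {L : ℝ}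
    (hL : 0 ≤ L) (hgL : ∀ x y, |g x - g y| ≤ L * |x - y|) :
    Continuous fun X : Fin m → Fin n → ℝ =>
      ∑ i, g ((wishart_isHermitian (Matrix.of X)).eigenvalues i) := by
  refine continuous_iff_continuousAt.2 fun X => ?_
  rw [ContinuousAt, tendsto_iff_dist_tendsto_zero]
  have hc : Continuous fun Y : Fin m → Fin n → ℝ => L * (√(Fintype.card (Fin n)) *
      √(∑ i, ∑ j, (wishart (Matrix.of Y) i j - wishart (Matrix.of X) i j) ^ 2)) := by
    simp only [wishart, Matrix.smul_apply, Matrix.mul_apply, Matrix.transpose_apply,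
      Matrix.of_apply, smul_eq_mul]
    fun_prop
  refine squeeze_zero (fun _ => dist_nonneg) (fun Y => ?_)
    ((hc.tendsto X).trans (le_of_eq ?_))
  · rw [Real.dist_eq]
    exact abs_sum_convex_eigenvalues_sub_le _ _ hg hL hgL
  · simp

theorem tendsto_ramp (t x : ℝ) :
    Tendsto (fun k : ℕ => (k + 1 : ℝ) * (max (t + (k + 1 : ℝ)⁻¹ - x) 0 - max (t - x) 0)) atTop
      (𝓝 (if x ≤ t then 1 else 0)) := by
  split_ifs with h
  · refine tendsto_const_nhds.congr fun k => ?_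
    have hk : (0 : ℝ) < (k + 1 : ℝ)⁻¹ := by positivity
    rw [max_eq_left (by linarith), max_eq_left (by linarith)]
    field_simp
    ring
  · push Not at h
    refine tendsto_const_nhds.congr' ?_
    have h0 : Tendsto (fun k : ℕ => (k + 1 : ℝ)⁻¹) atTop (𝓝 0) := by
      simpa using tendsto_one_div_add_atTop_nhds_zero_nat (𝕜 := ℝ)
    filter_upwards [h0.eventually (gt_mem_nhds (sub_pos.2 h))] with k hk
    rw [max_eq_right (by linarith), max_eq_right (by linarith)]
    simp

/-- The sums of `(s - λ_i)₊` are traces of convex Lipschitz functions, hence continuous in `X`; the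
count is the limit of their difference quotients from the right of `t`. -/
theorem measurable_card_eigenvalues_wishart_le (t : ℝ) :
    Measurable fun X : Fin m → Fin n → ℝ => ((Finset.univ.filter fun i =>
      (wishart_isHermitian (Matrix.of X)).eigenvalues i ≤ t).card : ℝ) := by
  have hcont (s : ℝ) : Continuous fun X : Fin m → Fin n → ℝ =>
      ∑ i, max (s - (wishart_isHermitian (Matrix.of X)).eigenvalues i) 0 := by
    refine continuous_sum_convex_eigenvalues_wishart (g := fun x => max (s - x) 0) (L := 1)
      ?_ zero_le_one fun x y => ?_
    · exact ((convexOn_const s convex_univ).sub (concaveOn_id convex_univ)).sup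
        (convexOn_const 0 convex_univ)
    · refine (abs_max_sub_max_le_abs _ _ _).trans (le_of_eq ?_)
      rw [one_mul, abs_sub_comm x y]
      congr 1
      ring
  refine measurable_of_tendsto_metrizable (f := fun (k : ℕ) (X : Fin m → Fin n → ℝ) =>
    (k + 1 : ℝ) * (∑ i, max (t + (k + 1 : ℝ)⁻¹ -
      (wishart_isHermitian (Matrix.of X)).eigenvalues i) 0 -
      ∑ i, max (t - (wishart_isHermitian (Matrix.of X)).eigenvalues i) 0)) (fun k =>
    (((hcont _).sub (hcont _)).measurable.const_mul _)) (tendsto_pi_nhds.2 fun X => ?_)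
  simp only [← Finset.sum_sub_distrib, Finset.mul_sum, Finset.card_filter, Nat.cast_sum,
    Nat.cast_ite, Nat.cast_one, Nat.cast_zero]
  exact tendsto_finsetSum _ fun i _ => tendsto_ramp t _

theorem measurable_eigenvalues₀_wishart (k : Fin (Fintype.card (Fin n))) :
    Measurable fun X : Fin m → Fin n → ℝ =>
      (wishart_isHermitian (Matrix.of X)).eigenvalues₀ k := by
  refine measurable_of_Iic fun t => ?_
  have : (fun X : Fin m → Fin n → ℝ => (wishart_isHermitian (Matrix.of X)).eigenvalues₀ k) ⁻¹'
      Set.Iic t = {X | (Fintype.card (Fin n) - k : ℝ) ≤ ((Finset.univ.filter fun i =>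
        (wishart_isHermitian (Matrix.of X)).eigenvalues i ≤ t).card : ℝ)} := by
    ext X
    rw [Set.mem_preimage, Set.mem_Iic, eigenvalues₀_le_iff, Set.mem_ofPred_eq, sub_le_iff_le_add']
    exact_mod_cast Iff.rfl
  rw [this]
  exact measurableSet_le measurable_const (measurable_card_eigenvalues_wishart_le t)

theorem measurable_spectralIntegral_wishart {f : ℝ → ℝ} (hf : Measurable f) :
    Measurable fun X : Fin m → Fin n → ℝ =>
      spectralIntegral (wishart_isHermitian (Matrix.of X)) f := by
  simp only [spectralIntegral, sum_eigenvalues_eq_sum_eigenvalues₀]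
  exact (Finset.measurable_sum _ fun k _ =>
    hf.comp (measurable_eigenvalues₀_wishart k)).const_mul _

end Measurability

/-! ### Medians -/

section Median

open Filter Topology

variable {Ω : Type*} [MeasurableSpace Ω] {μ : Measure Ω}

/-- Covers Lipschitz constant zero, where `expNegDiv` is 0. -/
theorem IsMedian.measureReal_abs_sub_eq_zero {T : Ω → ℝ} (h : ∀ ω ω', T ω = T ω') {M : ℝ}
    (hM : IsMedian μ T M) {ε : ℝ} (hε : 0 < ε) : μ.real {ω | ε ≤ |T ω - M|} = 0 := by
  have hne {s : Set Ω} (hs : 1 / 2 ≤ μ.real s) : s.Nonempty := by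
    rw [Set.nonempty_iff_ne_empty]
    rintro rfl
    norm_num at hs
  obtain ⟨a, ha⟩ := hne hM.1
  obtain ⟨b, hb⟩ := hne hM.2
  have : {ω | ε ≤ |T ω - M|} = ∅ := by
    refine Set.eq_empty_of_forall_notMem fun ω hω => ?_
    have h1 : T ω = M := le_antisymm (h ω a ▸ ha) (h ω b ▸ hb)
    have h2 : ε ≤ |T ω - M| := hω
    rw [h1, sub_self, abs_zero] at h2
    linarith
  rw [this, measureReal_empty]

variable [IsProbabilityMeasure μ]

/-- The leftmost point where the c.d.f. reaches 1/2: right continuity gives one inequality, the left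
limit the other. -/
theorem exists_isMedian {T : Ω → ℝ} (hT : Measurable T) : ∃ M, IsMedian μ T M := by
  have hprob : IsProbabilityMeasure (μ.map T) := Measure.isProbabilityMeasure_map hT.aemeasurable
  set G := cdf (μ.map T) with hG
  set S := {x : ℝ | 1 / 2 ≤ G x} with hS
  have hne : S.Nonempty := by
    obtain ⟨x, hx⟩ := ((tendsto_cdf_atTop (μ.map T)).eventually
      (lt_mem_nhds (by norm_num : (1 / 2 : ℝ) < 1))).exists
    exact ⟨x, hx.le⟩
  have hbdd : BddBelow S := by
    obtain ⟨x, hx⟩ := ((tendsto_cdf_atBot (μ.map T)).eventually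
      (gt_mem_nhds (by norm_num : (0 : ℝ) < 1 / 2))).exists
    refine ⟨x, fun y hy => ?_⟩
    by_contra! hlt
    exact absurd (hy.trans (monotone_cdf (μ.map T) hlt.le)) (not_le.2 hx)
  have hmap {s : Set ℝ} (hs : MeasurableSet s) : (μ.map T).real s = μ.real (T ⁻¹' s) :=
    map_measureReal_apply hT hs
  refine ⟨sInf S, ?_, ?_⟩
  · have h1 : 1 / 2 ≤ G (sInf S) := by
      refine ge_of_tendsto ((G.right_continuous (sInf S)).mono_left
        (nhdsWithin_mono _ Set.Ioi_subset_Ici_self)) ?_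
      filter_upwards [self_mem_nhdsWithin] with y hy
      obtain ⟨z, hz, hzy⟩ := exists_lt_of_csInf_lt hne hy
      exact le_trans hz (monotone_cdf (μ.map T) hzy.le)
    rw [hG, cdf_eq_real, hmap measurableSet_Iic] at h1
    exact h1
  · have h2 : (μ.map T).real (Set.Iio (sInf S)) ≤ 1 / 2 := by
      have hlim : Function.leftLim G (sInf S) ≤ 1 / 2 := by
        refine le_of_tendsto (G.mono.tendsto_leftLim (sInf S)) ?_
        filter_upwards [self_mem_nhdsWithin] with y hy
        by_contra! hlt
        exact absurd (csInf_le hbdd (show y ∈ S from hlt.le)) (not_le.2 hy)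
      have hm := G.measure_Iio (tendsto_cdf_atBot (μ.map T)) (sInf S)
      rw [hG, measure_cdf, sub_zero] at hm
      rw [Measure.real, hm]
      exact ENNReal.toReal_le_of_le_ofReal (by norm_num) (ENNReal.ofReal_le_ofReal hlim)
    rw [hmap measurableSet_Iio] at h2
    have h3 : {ω | sInf S ≤ T ω} = (T ⁻¹' Set.Iio (sInf S))ᶜ := by
      ext ω; simp
    rw [h3, probReal_compl_eq_one_sub (hT measurableSet_Iio)]
    linarith

theorem measureReal_abs_sub_integral_eq_zero {T : Ω → ℝ} (h : ∀ ω ω', T ω = T ω') {ε : ℝ}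
    (hε : 0 < ε) : μ.real {ω | ε ≤ |T ω - ∫ ω', T ω' ∂μ|} = 0 := by
  have : {ω | ε ≤ |T ω - ∫ ω', T ω' ∂μ|} = ∅ := by
    refine Set.eq_empty_of_forall_notMem fun ω hω => ?_
    have h1 : ∫ ω', T ω' ∂μ = T ω := by
      rw [integral_congr_ae (Eventually.of_forall fun ω' => h ω' ω)]
      simp
    have h2 : ε ≤ |T ω - ∫ ω', T ω' ∂μ| := hω
    rw [h1, sub_self, abs_zero] at h2
    linarith
  rw [this, measureReal_empty]

/-- A product bound on opposite tails gives concentration around any median. -/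
theorem IsMedian.measureReal_abs_sub_ge_le {T : Ω → ℝ} {r ε : ℝ}
    (h : ∀ M, μ.real {ω | T ω ≤ M} * μ.real {ω | M + ε ≤ T ω} ≤ r) {M : ℝ}
    (hM : IsMedian μ T M) : μ.real {ω | ε ≤ |T ω - M|} ≤ 4 * r := by
  have h1 := h M
  -- The product bound treats both tails alike: at `M` the first factor is at least 1/2, at `M - ε`
  -- the second is, so each tail is at most `2r`.
  have h2 := h (M - ε)
  rw [sub_add_cancel] at h2
  have h3 := mul_le_mul_of_nonneg_right hM.1 (measureReal_nonneg (μ := μ) (s := {ω | M + ε ≤ T ω}))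
  have h4 := mul_le_mul_of_nonneg_left hM.2 (measureReal_nonneg (μ := μ) (s := {ω | T ω ≤ M - ε}))
  have hsub : {ω | ε ≤ |T ω - M|} ⊆ {ω | M + ε ≤ T ω} ∪ {ω | T ω ≤ M - ε} := by
    intro ω hω
    rcases le_abs.1 (show ε ≤ |T ω - M| from hω) with h | h
    · left; change M + ε ≤ T ω; linarith
    · right; change T ω ≤ M - ε; linarith
  have := (measureReal_mono (μ := μ) hsub).trans (measureReal_union_le _ _)
  linarith

end Median

theorem abs_sub_le_lipConst_mul {g : ℝ → ℝ} (hg : ∃ K : ℝ≥0, LipschitzWith K g) (x y : ℝ) :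
    |g x - g y| ≤ lipConst g * |x - y| := by
  rcases eq_or_ne x y with rfl | hxy
  · simp
  have hpos : 0 < |x - y| := abs_pos.2 (sub_ne_zero.2 hxy)
  have h1 : Real.toNNReal (|g x - g y| / |x - y|) ≤ sInf {K : ℝ≥0 | LipschitzWith K g} := by
    refine le_csInf hg fun K hK => ?_
    rw [Real.toNNReal_le_iff_le_coe, div_le_iff₀ hpos]
    simpa [Real.dist_eq] using hK.dist_le_mul x y
  rw [Real.toNNReal_le_iff_le_coe, div_le_iff₀ hpos] at h1
  exact h1

/-! ### Transfer from product measures to independent rows -/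

section RowIndependence

variable {Ω : Type*} [MeasurableSpace Ω] {μ : Measure Ω} [IsProbabilityMeasure μ]
  {E : Type*} [MeasurableSpace E] {m : ℕ} {Y : Fin m → Ω → E}

theorem hasSubgaussianMGF_of_bounded_differences (hY : ∀ i, Measurable (Y i)) (hind : iIndepFun Y μ)
    {T : (Fin m → E) → ℝ} (hT : Measurable T) {C : ℝ} (hC : ∀ x, |T x| ≤ C) {d : ℝ≥0}
    (h : ∀ x i z, |T x - T (Function.update x i z)| ≤ d) :
    HasSubgaussianMGF (fun ω => T (fun i => Y i ω) - ∫ ω', T (fun i => Y i ω') ∂μ)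
      (m * d ^ 2 / 4) μ := by
  have hlaw := hind.map_fun_eq_pi_map fun i => (hY i).aemeasurable
  have hYm : Measurable fun ω i => Y i ω := measurable_pi_iff.2 hY
  have (i : Fin m) : IsProbabilityMeasure (μ.map (Y i)) :=
    Measure.isProbabilityMeasure_map (hY i).aemeasurable
  have key := hasSubgaussianMGF_pi_of_bounded_differences (fun i => μ.map (Y i)) hT hC h
  rw [← hlaw, integral_map hYm.aemeasurable hT.aestronglyMeasurable] at key
  exact key.of_map hYm.aemeasurable

theorem integrable_and_tail_of_bounded_differences (hm : 0 < m) (hY : ∀ i, Measurable (Y i))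
    (hind : iIndepFun Y μ) {T : (Fin m → E) → ℝ} (hT : Measurable T) {C : ℝ} (hC : ∀ x, |T x| ≤ C)
    {d : ℝ} (hd : 0 < d) (h : ∀ x i z, |T x - T (Function.update x i z)| ≤ d) :
    Integrable (fun ω => T (fun i => Y i ω)) μ ∧ ∀ ε : ℝ, 0 < ε →
      μ.real {ω | ε ≤ |T (fun i => Y i ω) - ∫ ω', T (fun i => Y i ω') ∂μ|} ≤
        2 * Real.exp (-(2 * ε ^ 2 / (m * d ^ 2))) := by
  have hYm : Measurable fun ω i => Y i ω := measurable_pi_iff.2 hY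
  lift d to ℝ≥0 using hd.le
  refine ⟨Integrable.of_bound (hT.comp hYm).aestronglyMeasurable C
    (Filter.Eventually.of_forall fun _ => hC _), fun ε hε => ?_⟩
  refine (measureReal_abs_sub_integral_ge_le
    (hasSubgaussianMGF_of_bounded_differences hY hind hT hC h) hε.le).trans (le_of_eq ?_)
  congr 2
  push_cast
  field_simp
  norm_num

variable [NormedAddCommGroup E] [NormedSpace ℝ E] [FiniteDimensional ℝ E] [BorelSpace E]
  {κ : ℝ} {B : Set E} {F : (Fin m → E) → ℝ} {Λ : ℝ}

theorem measureReal_le_mul_measureReal_ge_le (hY : ∀ i, Measurable (Y i)) (hind : iIndepFun Y μ)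
    (hκ : 0 ≤ κ) (hBm : MeasurableSet B) (hB : ∀ x ∈ B, ∀ y ∈ B, κ * ‖x - y‖ ^ 2 ≤ 1 / 4)
    (hYB : ∀ i, ∀ᵐ ω ∂μ, Y i ω ∈ B) (hc : ConvexOn ℝ Set.univ F) (hΛ : 0 < Λ)
    (hF : ∀ x y, |F x - F y| ≤ Λ * √(∑ i, ‖x i - y i‖ ^ 2)) (M : ℝ) {t : ℝ} (ht : 0 < t) :
    μ.real {ω | F (fun i => Y i ω) ≤ M} * μ.real {ω | M + t ≤ F (fun i => Y i ω)} ≤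
      Real.exp (-(κ * t ^ 2 / Λ ^ 2)) := by
  have hlaw := hind.map_fun_eq_pi_map fun i => (hY i).aemeasurable
  have hYm : Measurable fun ω i => Y i ω := measurable_pi_iff.2 hY
  have (i : Fin m) : IsProbabilityMeasure (μ.map (Y i)) :=
    Measure.isProbabilityMeasure_map (hY i).aemeasurable
  have hFm : Measurable F := hc.continuous_of_univ.measurable
  have key := measure_le_mul_measure_ge_le hκ hB (fun i => μ.map (Y i))
    (fun i => (ae_map_iff (hY i).aemeasurable hBm).2 (hYB i)) hc hΛ hF M ht
  rwa [← hlaw, map_measureReal_apply hYm (measurableSet_le hFm measurable_const),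
    map_measureReal_apply hYm (measurableSet_le measurable_const hFm)] at key

theorem hasSubgaussianMGF_of_convex_lipschitz (hY : ∀ i, Measurable (Y i)) (hind : iIndepFun Y μ)
    (hκ : 0 < κ) (hBm : MeasurableSet B) (hB : ∀ x ∈ B, ∀ y ∈ B, κ * ‖x - y‖ ^ 2 ≤ 1 / 4)
    (hYB : ∀ i, ∀ᵐ ω ∂μ, Y i ω ∈ B) (hc : ConvexOn ℝ Set.univ F)
    (hF : ∀ x y, |F x - F y| ≤ Λ * √(∑ i, ‖x i - y i‖ ^ 2)) {b C : ℝ} (hb : ∀ x, b ≤ F x)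
    (hC : ∀ᵐ ω ∂μ, |F (fun i => Y i ω)| ≤ C) {v : ℝ≥0} (hv : (v : ℝ) = Λ ^ 2 / (4 * κ)) :
    HasSubgaussianMGF (fun ω => F (fun i => Y i ω) - ∫ ω', F (fun i => Y i ω') ∂μ) (2 * v) μ := by
  have hlaw := hind.map_fun_eq_pi_map fun i => (hY i).aemeasurable
  have hYm : Measurable fun ω i => Y i ω := measurable_pi_iff.2 hY
  have (i : Fin m) : IsProbabilityMeasure (μ.map (Y i)) :=
    Measure.isProbabilityMeasure_map (hY i).aemeasurable
  have hFm : Measurable F := hc.continuous_of_univ.measurable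
  have hFYm : Measurable fun ω => F (fun i => Y i ω) := hFm.comp hYm
  refine hasSubgaussianMGF_of_integral_exp_mul_le hFYm hC fun a ha => ?_
  have key := lintegral_exp_mul_lintegral_exp_neg_le hκ hB (fun i => μ.map (Y i))
    (fun i => (ae_map_iff (hY i).aemeasurable hBm).2 (hYB i)) hc hF hb ha
  rw [← hlaw, lintegral_map (by fun_prop) hYm, lintegral_map (by fun_prop) hYm] at key
  rw [integral_eq_lintegral_of_nonneg_ae (Filter.Eventually.of_forall fun _ => (Real.exp_pos _).le)
      (hFYm.const_mul a).exp.aestronglyMeasurable, integral_eq_lintegral_of_nonneg_ae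
      (Filter.Eventually.of_forall fun _ => (Real.exp_pos _).le)
      (hFYm.const_mul a).fun_neg.exp.aestronglyMeasurable,
    ← ENNReal.toReal_mul, hv, ← mul_div_assoc]
  exact ENNReal.toReal_le_of_le_ofReal (Real.exp_pos _).le key

end RowIndependence

/-! ### Bounded entries -/

section Bounded

open Matrix

variable {m n : ℕ}

/-- The spectral integral of the Wishart matrix, as a function of the rows. -/
noncomputable def rowSpectralIntegral (f : ℝ → ℝ) (x : Fin m → EuclideanSpace ℝ (Fin n)) : ℝ :=
  spectralIntegral (wishart_isHermitian (Matrix.of fun i j => x i j)) f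

theorem convexOn_rowSpectralIntegral (hn : 0 < n) {f : ℝ → ℝ}
    (hf : ConvexOn ℝ Set.univ fun x : ℝ => f (x ^ 2)) :
    ConvexOn ℝ Set.univ (rowSpectralIntegral (m := m) (n := n) f) :=
  ⟨convex_univ, fun x _ y _ _ _ ha hb hab =>
    (convexOn_spectralIntegral_wishart hn hf).2 (Set.mem_univ (Matrix.of fun i j => x i j))
      (Set.mem_univ (Matrix.of fun i j => y i j)) ha hb hab⟩

theorem abs_rowSpectralIntegral_sub_le (hn : 0 < n) {f : ℝ → ℝ}
    (hf : ConvexOn ℝ Set.univ fun x : ℝ => f (x ^ 2)) {L : ℝ} (hL : 0 ≤ L)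
    (hfL : ∀ x y : ℝ, |f (x ^ 2) - f (y ^ 2)| ≤ L * |x - y|)
    (x y : Fin m → EuclideanSpace ℝ (Fin n)) :
    |rowSpectralIntegral f x - rowSpectralIntegral f y| ≤
      L * √((n + m) / (2 * n ^ 2 * m)) * √(∑ i, ‖x i - y i‖ ^ 2) := by
  have := abs_spectralIntegral_wishart_sub_le hn hf hL hfL (Matrix.of fun i j => x i j)
    (Matrix.of fun i j => y i j)
  simpa [EuclideanSpace.norm_sq_eq] using! this

theorem eigenvalues_wishart_nonneg (X : Matrix (Fin m) (Fin n) ℝ) (i : Fin n) :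
    0 ≤ (wishart_isHermitian X).eigenvalues i := by
  rw [← eigenvectorBasis_dotProduct_mulVec, dotProduct_wishart_mulVec]
  positivity

/-- The even convex function `f(·²)` is minimal at 0. This supplies the lower bound that the Laplace
transform argument requires. -/
theorem le_rowSpectralIntegral (hn : 0 < n) {f : ℝ → ℝ}
    (hf : ConvexOn ℝ Set.univ fun x : ℝ => f (x ^ 2)) (x : Fin m → EuclideanSpace ℝ (Fin n)) :
    f 0 ≤ rowSpectralIntegral f x := by
  have h (y : ℝ) (hy : 0 ≤ y) : f 0 ≤ f y := by
    have := hf.2 (Set.mem_univ (√y)) (Set.mem_univ (-√y)) (by norm_num : (0 : ℝ) ≤ 1 / 2)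
      (by norm_num : (0 : ℝ) ≤ 1 / 2) (by norm_num)
    simp [Real.sq_sqrt hy] at this
    linarith
  have hn' : (0 : ℝ) < n := by exact_mod_cast hn
  rw [rowSpectralIntegral, spectralIntegral, le_inv_mul_iff₀ hn']
  calc (n : ℝ) * f 0 = ∑ _i : Fin n, f 0 := by simp
    _ ≤ _ := Finset.sum_le_sum fun i _ => h _ (eigenvalues_wishart_nonneg _ i)

theorem norm_sub_sq_le_of_abs_le_one {x y : EuclideanSpace ℝ (Fin n)} (hx : ∀ j, |x j| ≤ 1)
    (hy : ∀ j, |y j| ≤ 1) : ‖x - y‖ ^ 2 ≤ 4 * n := by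
  rw [EuclideanSpace.norm_sq_eq]
  calc ∑ j, ‖(x - y) j‖ ^ 2 ≤ ∑ _j : Fin n, (4 : ℝ) := by
        refine Finset.sum_le_sum fun j _ => ?_
        have h1 := abs_le.1 (hx j)
        have h2 := abs_le.1 (hy j)
        rw [PiLp.sub_apply, Real.norm_eq_abs, sq_abs]
        nlinarith
    _ = 4 * n := by simp [mul_comm]

theorem concentration_of_bounded_entries {Ω : Type*} [MeasurableSpace Ω] {μ : Measure Ω}
    [IsProbabilityMeasure μ] (hm : 0 < m) (hn : 0 < n) {X : Ω → Matrix (Fin m) (Fin n) ℝ}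
    (hX : ∀ i j, Measurable fun ω => X ω i j)
    (hind : iIndepFun (fun (i : Fin m) (ω : Ω) => (X ω).row i) μ) {f : ℝ → ℝ}
    (hX1 : ∀ i j, ∀ᵐ ω ∂μ, |X ω i j| ≤ 1) (hf : ConvexOn ℝ Set.univ (fun x : ℝ => f (x ^ 2)))
    (hLip : ∃ K : ℝ≥0, LipschitzWith K (fun x : ℝ => f (x ^ 2))) :
    let T : Ω → ℝ := fun ω => spectralIntegral (wishart_isHermitian (X ω)) f
    let L : ℝ := lipConst (fun x : ℝ => f (x ^ 2))
    (∃ M, IsMedian μ T M) ∧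
    (∀ M, IsMedian μ T M → ∀ ε : ℝ, 0 < ε →
      μ.real {ω | ε ≤ |T ω - M|} ≤
        4 * expNegDiv ((n * m : ℝ) / (n + m : ℝ) * ε ^ 2) (8 * L ^ 2)) ∧
    Integrable T μ ∧
    (∀ ε : ℝ, 0 < ε →
      μ.real {ω | ε ≤ |T ω - ∫ ω', T ω' ∂μ|} ≤
        2 * expNegDiv (1 / 8 * ((n * m : ℝ) / (n + m : ℝ)) * ε ^ 2) (L ^ 2)) := by
  intro T L
  have hmr : (0 : ℝ) < m := by exact_mod_cast hm
  have hnr : (0 : ℝ) < n := by exact_mod_cast hn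
  have hL : 0 ≤ L := NNReal.coe_nonneg _
  have hfL : ∀ x y : ℝ, |f (x ^ 2) - f (y ^ 2)| ≤ L * |x - y| := abs_sub_le_lipConst_mul hLip
  set Y : Fin m → Ω → EuclideanSpace ℝ (Fin n) := fun i ω => WithLp.toLp 2 ((X ω).row i)
  have hrow (i : Fin m) : Measurable fun ω => (X ω).row i := measurable_pi_iff.2 fun j => hX i j
  have htoLp : Measurable (WithLp.toLp 2 : (Fin n → ℝ) → EuclideanSpace ℝ (Fin n)) := by fun_prop
  have hY (i : Fin m) : Measurable (Y i) := htoLp.comp (hrow i)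
  have hYind : iIndepFun Y μ := hind.comp (fun _ => WithLp.toLp 2) fun _ => htoLp
  have hTY (ω : Ω) : T ω = rowSpectralIntegral f fun i => Y i ω := rfl
  clear_value T
  obtain rfl : T = fun ω => rowSpectralIntegral f fun i => Y i ω := funext hTY
  set T : Ω → ℝ := fun ω => rowSpectralIntegral f fun i => Y i ω
  set B : Set (EuclideanSpace ℝ (Fin n)) := {x | ∀ j, |x j| ≤ 1} with hBdef
  have hBm : MeasurableSet B := by
    have : B = ⋂ j, {x : EuclideanSpace ℝ (Fin n) | |x j| ≤ 1} := by ext x; simp [hBdef]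
    rw [this]
    exact MeasurableSet.iInter fun j => measurableSet_le (by fun_prop) measurable_const
  have hYB (i : Fin m) : ∀ᵐ ω ∂μ, Y i ω ∈ B := ae_all_iff.2 fun j => hX1 i j
  -- Rows with entries in `[-1, 1]` are at squared distance at most `4n`, and Maurey's inequality
  -- asks for `κ · 4n ≤ 1/4`. Then `κε²/Λ² = (nm/(n+m)) ε²/(8L²)`.
  have hκ : (0 : ℝ) < 1 / (16 * n) := by positivity
  have hB : ∀ x ∈ B, ∀ y ∈ B, 1 / (16 * n : ℝ) * ‖x - y‖ ^ 2 ≤ 1 / 4 := by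
    intro x hx y hy
    calc 1 / (16 * n : ℝ) * ‖x - y‖ ^ 2 ≤ 1 / (16 * n : ℝ) * (4 * n) := by
          gcongr; exact norm_sub_sq_le_of_abs_le_one hx hy
      _ = 1 / 4 := by field_simp; norm_num
  have hc := convexOn_rowSpectralIntegral (m := m) hn hf
  have hFL := abs_rowSpectralIntegral_sub_le (m := m) hn hf hL hfL
  set Λ := L * √((n + m) / (2 * n ^ 2 * m) : ℝ) with hΛ
  have hΛ0 : 0 ≤ Λ := by positivity
  have hΛ2 : Λ ^ 2 = L ^ 2 * ((n + m) / (2 * n ^ 2 * m)) := by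
    rw [hΛ, mul_pow, Real.sq_sqrt (by positivity)]
  have hFm := hc.continuous_of_univ.measurable
  have hTm : Measurable T := hFm.comp (measurable_pi_iff.2 hY)
  have hTb : ∀ᵐ ω ∂μ, |T ω| ≤ |rowSpectralIntegral f (fun _ : Fin m =>
      (0 : EuclideanSpace ℝ (Fin n)))| + Λ * √(∑ _i : Fin m, 4 * (n : ℝ)) := by
    filter_upwards [ae_all_iff.2 hYB] with ω hω
    have h1 := hFL (fun i => Y i ω) fun _ => 0
    have h2 : √(∑ i, ‖Y i ω - 0‖ ^ 2) ≤ √(∑ _i : Fin m, 4 * (n : ℝ)) :=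
      Real.sqrt_le_sqrt (Finset.sum_le_sum fun i _ =>
        norm_sub_sq_le_of_abs_le_one (hω i) (by simp))
    have h3 := abs_sub_abs_le_abs_sub (T ω) (rowSpectralIntegral f (fun _ : Fin m =>
      (0 : EuclideanSpace ℝ (Fin n))))
    have h4 := mul_le_mul_of_nonneg_left h2 hΛ0
    rw [← hTY] at h1
    linarith
  have hTi : Integrable T μ := Integrable.of_bound hTm.aestronglyMeasurable _ hTb
  refine ⟨exists_isMedian hTm, fun M hM ε hε => ?_, hTi, fun ε hε => ?_⟩
  · rcases hL.eq_or_lt with h0 | hLpos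
    · have hconst (ω ω' : Ω) : T ω = T ω' := by
        have := hFL (fun i => Y i ω) fun i => Y i ω'
        rw [hΛ, ← h0, zero_mul, zero_mul] at this
        exact sub_eq_zero.1 (abs_nonpos_iff.1 this)
      rw [hM.measureReal_abs_sub_eq_zero hconst hε, expNegDiv]
      split_ifs <;> positivity
    · have hΛpos : 0 < Λ := by positivity
      rw [expNegDiv, if_neg (by positivity)]
      refine hM.measureReal_abs_sub_ge_le fun M' => ?_
      refine (measureReal_le_mul_measureReal_ge_le hY hYind hκ.le hBm hB hYB hc hΛpos hFL M'
        hε).trans (le_of_eq ?_)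
      rw [hΛ2]
      congr 2
      field_simp
      norm_num
  · rcases hL.eq_or_lt with h0 | hLpos
    · have hconst (ω ω' : Ω) : T ω = T ω' := by
        have := hFL (fun i => Y i ω) fun i => Y i ω'
        rw [hΛ, ← h0, zero_mul, zero_mul] at this
        exact sub_eq_zero.1 (abs_nonpos_iff.1 this)
      rw [measureReal_abs_sub_integral_eq_zero hconst hε, expNegDiv]
      split_ifs <;> positivity
    · rw [expNegDiv, if_neg (by positivity)]
      obtain ⟨v, hv⟩ : ∃ v : ℝ≥0, (v : ℝ) = Λ ^ 2 / (4 * (1 / (16 * n))) :=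
        ⟨_, Real.coe_toNNReal _ (by positivity)⟩
      have hsub := hasSubgaussianMGF_of_convex_lipschitz hY hYind hκ hBm hB hYB hc hFL
        (le_rowSpectralIntegral hn hf) hTb
        hv
      refine (measureReal_abs_sub_integral_ge_le hsub hε.le).trans (le_of_eq ?_)
      congr 2
      push_cast
      rw [hv, hΛ2]
      field_simp
      norm_num

end Bounded

end SpectralConcentration

/-! ### The concentration theorem -/

theorem theorem1 :
    ∃ C c : ℝ, 0 < C ∧ 0 < c ∧
    ∀ (Ω : Type*) [MeasurableSpace Ω] (μ : Measure Ω) [IsProbabilityMeasure μ]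
      (m n : ℕ) (_ : 0 < m) (_ : 0 < n)
      (X : Ω → Matrix (Fin m) (Fin n) ℝ)
      (_ : ∀ i j, Measurable fun ω => X ω i j)
      (_ : iIndepFun (fun (i : Fin m) (ω : Ω) => (X ω).row i) μ)
      (f : ℝ → ℝ),
    -- part (i)
    ((∀ i j, ∀ᵐ ω ∂μ, |X ω i j| ≤ 1) →
      ConvexOn ℝ Set.univ (fun x : ℝ => f (x ^ 2)) →
      (∃ K : ℝ≥0, LipschitzWith K (fun x : ℝ => f (x ^ 2))) →
      let T : Ω → ℝ := fun ω =>
        SpectralConcentration.spectralIntegral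
          (SpectralConcentration.wishart_isHermitian (X ω)) f
      let L : ℝ := SpectralConcentration.lipConst (fun x : ℝ => f (x ^ 2))
      (∃ M, SpectralConcentration.IsMedian μ T M) ∧
      (∀ M, SpectralConcentration.IsMedian μ T M → ∀ ε : ℝ, 0 < ε →
        μ.real {ω | ε ≤ |T ω - M|} ≤
          4 * SpectralConcentration.expNegDiv
            ((n * m : ℝ) / (n + m : ℝ) * ε ^ 2) (8 * L ^ 2)) ∧
      Integrable T μ ∧
      (∀ ε : ℝ, 0 < ε →
        μ.real {ω | ε ≤ |T ω - ∫ ω', T ω' ∂μ|} ≤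
          C * SpectralConcentration.expNegDiv
            (c * ((n * m : ℝ) / (n + m : ℝ)) * ε ^ 2) (L ^ 2))) ∧
    -- part (ii)
    (BoundedVariationOn f Set.univ →
      let T : Ω → ℝ := fun ω =>
        SpectralConcentration.spectralIntegral
          (SpectralConcentration.wishart_isHermitian (X ω)) f
      Integrable T μ ∧
      ∀ ε : ℝ, 0 < ε →
        μ.real {ω | ε ≤ |T ω - ∫ ω', T ω' ∂μ|} ≤
          2 * SpectralConcentration.expNegDiv
            ((n : ℝ) ^ 2 / m * (2 * ε ^ 2)) (SpectralConcentration.totalVariation f ^ 2)) ∧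
    -- part (ii), the empirical spectral c.d.f. at a point
    (∀ t : ℝ,
      let F : Ω → ℝ := fun ω =>
        SpectralConcentration.spectralCDF
          (SpectralConcentration.wishart_isHermitian (X ω)) t
      Integrable F μ ∧
      ∀ ε : ℝ, 0 < ε →
        μ.real {ω | ε ≤ |F ω - ∫ ω', F ω' ∂μ|} ≤
          2 * Real.exp (-((n : ℝ) ^ 2 / m * (2 * ε ^ 2)))) := by
  open SpectralConcentration in
  -- The Laplace transform bound gives the mean the same exponent as the median, with prefactor 2
  -- from the two tails.
  refine ⟨2, 1 / 8, by norm_num, by norm_num, ?_⟩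
  intro Ω _ μ _ m n hm hn X hX hind f
  have hmr : (0 : ℝ) < m := by exact_mod_cast hm
  have hnr : (0 : ℝ) < n := by exact_mod_cast hn
  have hrow (i : Fin m) : Measurable fun ω => (X ω).row i := measurable_pi_iff.2 fun j => hX i j
  refine ⟨concentration_of_bounded_entries hm hn hX hind, fun hf => ?_, fun t => ?_⟩
  · intro T
    have hdist (x y : ℝ) : |f x - f y| ≤ totalVariation f := by
      simpa [Real.dist_eq] using! hf.dist_le (Set.mem_univ x) (Set.mem_univ y)
    have hV : 0 ≤ totalVariation f := ENNReal.toReal_nonneg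
    have hfC (x : ℝ) : |f x| ≤ |f 0| + totalVariation f := by
      linarith [abs_sub_abs_le_abs_sub (f x) (f 0), hdist x 0]
    have hC (x : Fin m → Fin n → ℝ) :=
      abs_spectralIntegral_le (by positivity) hfC (wishart_isHermitian (Matrix.of x))
    have hTm := measurable_spectralIntegral_wishart (m := m) (n := n) hf.measurable
    -- Zero variation makes `f` constant, in agreement with the convention `exp (-a/0) = 0`;
    -- otherwise McDiarmid applies.
    rcases hV.eq_or_lt with h0 | hpos
    · have hconst (ω ω' : Ω) : T ω = T ω' := by
        have h1 (x y : ℝ) : f x = f y :=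
          sub_eq_zero.1 (abs_nonpos_iff.1 (h0 ▸ hdist x y))
        simp only [T, spectralIntegral]
        congr 1
        exact Finset.sum_congr rfl fun i _ => h1 _ _
      refine ⟨Integrable.of_bound (hTm.comp (measurable_pi_iff.2 hrow)).aestronglyMeasurable _
        (Filter.Eventually.of_forall fun ω => hC (X ω)), fun ε hε => ?_⟩
      rw [measureReal_abs_sub_integral_eq_zero hconst hε, expNegDiv]
      split_ifs <;> positivity
    · obtain ⟨h1, h2⟩ := integrable_and_tail_of_bounded_differences hm hrow hind hTm hC
        (d := (n : ℝ)⁻¹ * totalVariation f) (by positivity)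
        (fun x i z => abs_spectralIntegral_sub_updateRow_le hf (Matrix.of x) i z)
      refine ⟨h1, fun ε hε => (h2 ε hε).trans (le_of_eq ?_)⟩
      rw [expNegDiv, if_neg (by positivity)]
      congr 2
      field_simp
  -- The counting bound gives differences `1/n` directly, without passing through the variation of
  -- an indicator.
  · intro F
    have hTm : Measurable fun x : Fin m → Fin n → ℝ =>
        spectralCDF (wishart_isHermitian (Matrix.of x)) t :=
      (measurable_card_eigenvalues_wishart_le t).const_mul _
    obtain ⟨h1, h2⟩ := integrable_and_tail_of_bounded_differences hm hrow hind hTm (C := 1)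
      (fun x => by
        rw [spectralCDF, abs_of_nonneg (by positivity), inv_mul_le_iff₀ hnr, mul_one]
        exact_mod_cast (Finset.card_filter_le _ _).trans (by simp))
      (d := (n : ℝ)⁻¹) (by positivity)
      (fun x i z => abs_spectralCDF_sub_updateRow_le (Matrix.of x) i z t)
    refine ⟨h1, fun ε hε => (h2 ε hε).trans (le_of_eq ?_)⟩
    congr 2
    field_simp
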